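/- Fix $\kappa\in(0,1)$. For $n\in\mathbb N$ let $p_n(z)=z(z-\tfrac1n)\cdots(z-\tfrac{n-1}n)$. For a polynomial $P\not\equiv0$ of degree at most $n$ let $$[\![P]\!]_n=\frac1n\sum_{z\in\mathbb C:\,P(z)=0}\delta_z+\frac{n-\deg P}{n}\,\delta_\infty$$ (zeros counted with multiplicity), a probability measure on $\mathbb C\cup\{\infty\}$. Put $Y_\kappa(t)=\coth t-\kappa/t$ for real $t\neq0$. The equation $\sinh z=z/\sqrt\kappa$ has a unique positive solution $z_\kappa$, and $-1<Y_\kappa(-z_\kappa)<Y_\kappa(z_\kappa)<1$. The function $Y_\kappa$ is strictly decreasing on $(-z_\kappa,0)$ and on $(0,z_\kappa)$, and restricts to a bijection from $(-z_\kappa,0)\cup(0,z_\kappa)$ onto $\mathbb R\setminus[Y_\kappa(-z_\kappa),Y_\kappa(z_\kappa)]$; denote the inverse of this bijection by $Y_\kappa^{\leftarrow}$. As $n\to\infty$, the measures $\big[\!\big[(\tfrac{d}{dz})^{\lfloor\kappa n\rfloor}\,p_n\big(\tfrac{z+1}2\big)\big]\!\big]_n$ converge weakly on $\mathbb C\cup\{\infty\}$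 to a probability measure $\mu_\kappa$. It has an atom of mass exactly $\kappa$ at $\infty$ (coming from the $\lfloor\kappa n\rfloor$ zeros lost by differentiation), and its support is $[Y_\kappa(-z_\kappa),Y_\kappa(z_\kappa)]\cup\{\infty\}$, so that the remaining mass $1-\kappa$ lives on $[Y_\kappa(-z_\kappa),Y_\kappa(z_\kappa)]\subset(-1,1)$ and the support of this part is the whole interval. Its Cauchy transform satisfies $$G_{\mu_\kappa}(x):=\int_{\mathbb R}\frac{\mu_\kappa(dy)}{x-y}=Y_\kappa^{\leftarrow}(x),\qquad x\in\mathbb R\setminus[Y_\kappa(-z_\kappa),Y_\kappa(z_\kappa)].$$ -/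

import Mathlib

open Filter Topology MeasureTheory Polynomial
open scoped NNReal OnePoint

noncomputable section

namespace EquispacedDerivatives

/-- The Borel σ-algebra of the one-point compactification `ℂ ∪ {∞}`. -/
instance instMeasurableSpaceOnePoint : MeasurableSpace (OnePoint ℂ) := borel (OnePoint ℂ)

instance instBorelSpaceOnePoint : BorelSpace (OnePoint ℂ) := ⟨rfl⟩

/-- Empirical distribution of zeros of a real polynomial `P`, relative to an index `n ≥ deg P`:
weight `1 / n` at every complex zero (counted with multiplicity), the remaining mass
`(n - deg P) / n` at `∞`. -/
def zeroDist (n : ℕ) (P : ℝ[X]) : FiniteMeasure (OnePoint ℂ) :=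
  (n : ℝ≥0)⁻¹ •
    (((P.aroots ℂ).map
        fun z : ℂ => (diracProba (z : OnePoint ℂ)).toFiniteMeasure).sum +
      (n - P.natDegree) • (diracProba (∞ : OnePoint ℂ)).toFiniteMeasure)

/-- It is a probability measure whenever `1 ≤ n` and `deg P ≤ n`. -/
theorem zeroDist_mass (n : ℕ) (P : ℝ[X]) (hn : 1 ≤ n) (hP : P.natDegree ≤ n) :
    (zeroDist n P).mass = 1 := by
  have hcard : Multiset.card (P.aroots ℂ) = P.natDegree := by
    have h := IsAlgClosed.splits (P.map (algebraMap ℝ ℂ))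
    rw [Polynomial.aroots, ← h.natDegree_eq_card_roots, Polynomial.natDegree_map]
  have hsum : ∀ s : Multiset ℂ,
      ((s.map fun z : ℂ => (diracProba (z : OnePoint ℂ)).toFiniteMeasure).sum) Set.univ
        = (Multiset.card s : ℝ≥0) := by
    intro s
    induction s using Multiset.induction_on with
    | empty => simp
    | cons a s ih =>
      rw [Multiset.map_cons, Multiset.sum_cons, FiniteMeasure.coeFn_add, Pi.add_apply, ih]
      simp [add_comm]
  have hn' : (n : ℝ≥0) ≠ 0 := by exact_mod_cast (by omega : n ≠ 0)
  have key : (P.natDegree : ℝ≥0) + ((n - P.natDegree : ℕ) : ℝ≥0) = n := by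
    exact_mod_cast Nat.add_sub_cancel' hP
  unfold zeroDist FiniteMeasure.mass
  rw [FiniteMeasure.coeFn_smul, Pi.smul_apply, FiniteMeasure.coeFn_add, Pi.add_apply, hsum,
    hcard, FiniteMeasure.coeFn_smul, Pi.smul_apply]
  simp only [smul_eq_mul, nsmul_eq_mul, ProbabilityMeasure.coeFn_comp_toFiniteMeasure_eq_coeFn,
    ProbabilityMeasure.coeFn_univ, mul_one, key]
  exact inv_mul_cancel₀ hn'

/-- Cauchy transform `t ↦ ∫ μ(dz) / (t - z)` of a measure on `ℂ ∪ {∞}`; the point `∞`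
contributes `1 / (t - ∞) = 0`. -/
def cauchyTransform (μ : Measure (OnePoint ℂ)) (t : ℂ) : ℂ :=
  ∫ w, w.elim (0 : ℂ) (fun z : ℂ => 1 / (t - z)) ∂μ

/-- `p_n(z) = z (z - 1/n) ⋯ (z - (n-1)/n)`. -/
def equispacedPoly (n : ℕ) : ℝ[X] :=
  ∏ j ∈ Finset.range n, (X - C ((j : ℝ) / (n : ℝ)))

/-- `(d/dz)^{⌊κ n⌋} [p_n((z + 1) / 2)]`. -/
def rescaledDeriv (κ : ℝ) (n : ℕ) : ℝ[X] :=
  derivative^[⌊κ * (n : ℝ)⌋₊] ((equispacedPoly n).comp (C (1 / 2) * (X + 1)))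

/-- `Y_κ(t) = coth t - κ / t` (used for `t ≠ 0` only). -/
def Y (κ t : ℝ) : ℝ := Real.cosh t / Real.sinh t - κ / t

/-- The embedding of the real line into `ℂ ∪ {∞}`. -/
def realPt (x : ℝ) : OnePoint ℂ := ((x : ℂ) : OnePoint ℂ)

end EquispacedDerivatives

end

namespace EquispacedDerivatives

/-! The zeros of the rescaled polynomial `p` form an arithmetic progression, so `(y - 1) p(y) = (y +
1) p(y - 2/n)`. By Leibniz, this remains a relation between two consecutive derivatives after `m`
differentiations (`eval_iterate_derivative_shift`). Let `S` be the logarithmic derivative of the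
`m`-th derivative at `y > 1`. In the relation, the ratio of consecutive derivatives is about `1 /
S`, and the shift by `2/n` contributes about `exp (-2 S / n)`. With `m / n → κ`, every cluster value
`g` of `S / n` satisfies `(y - 1) + κ / g = exp (-2 g) ((y + 1) + κ / g)`, that is, `Y κ g = y`. A
value of `Y κ` above `1` is attained only once on `(0, ∞)`, so `g` is determined
(`tendsto_rootSum`). The Stieltjes transform on `(1, ∞)` determines a measure on `[-1, 1]`, and
compactness gives convergence (`exists_limit`).

The outer bound on the support comes from a barrier argument (`barrier_step`): if the logarithmic
derivative is at most `φ` at a point to the right of all zeros, differentiation moves this barrier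
left by `1 / φ`. Starting from `coth t` at level `n t`, all zeros of the `m`-th derivative lie below
`coth t - m / (n t)`; the best choice is the minimiser `t = z` of `Y κ`.

Finally, `G cosh G - κ sinh G = x G sinh G` continues analytically from `(1, ∞)` through the upper
half-plane to every real gap of the measure (`stieltjes_relation`). Outside the interval, `G` is
continuous and nonzero and cannot cross `±z`, so it is the claimed inverse branch. In a gap inside
the interval, a nonzero `G` would force `|x| ≥ Y κ z`; hence `G` would vanish there, although it is
strictly decreasing on a gap. So there is no such gap. -/

/-! ### The function `Y` and its critical point -/

theorem sinh_lt_mul_cosh {t : ℝ} (ht : 0 < t) : Real.sinh t < t * Real.cosh t := by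
  have hd : ∀ x : ℝ, HasDerivAt (fun t : ℝ => t * Real.cosh t - Real.sinh t)
      (x * Real.sinh x) x := fun x =>
    (((hasDerivAt_id' x).mul (Real.hasDerivAt_cosh x)).sub (Real.hasDerivAt_sinh x)).congr_deriv
      (by ring)
  have hmono : StrictMonoOn (fun t : ℝ => t * Real.cosh t - Real.sinh t) (Set.Ici 0) := by
    refine strictMonoOn_of_deriv_pos (convex_Ici 0)
      (fun x _ => (hd x).continuousAt.continuousWithinAt) fun x hx => ?_
    rw [interior_Ici] at hx
    rw [(hd x).deriv]
    exact mul_pos hx (Real.sinh_pos_iff.2 hx)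
  simpa using hmono Set.self_mem_Ici ht.le ht

theorem strictMonoOn_sinh_div : StrictMonoOn (fun t : ℝ => Real.sinh t / t) (Set.Ioi 0) := by
  have hd : ∀ x ∈ Set.Ioi (0 : ℝ), HasDerivAt (fun t : ℝ => Real.sinh t / t)
      ((Real.cosh x * x - Real.sinh x * 1) / x ^ 2) x := fun x hx =>
    (Real.hasDerivAt_sinh x).div (hasDerivAt_id x) (ne_of_gt hx)
  refine strictMonoOn_of_deriv_pos (convex_Ioi 0)
      (fun x hx => (hd x hx).continuousAt.continuousWithinAt) fun x hx => ?_
  rw [interior_Ioi] at hx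
  rw [(hd x hx).deriv]
  have := sinh_lt_mul_cosh hx
  have hx' : (0 : ℝ) < x := hx
  apply div_pos _ (by positivity)
  linarith

theorem existsUnique_critical {κ : ℝ} (hκ0 : 0 < κ) (hκ1 : κ < 1) :
    ∃! z : ℝ, 0 < z ∧ Real.sinh z = z / Real.sqrt κ := by
  have hs : 0 < Real.sqrt κ := Real.sqrt_pos.2 hκ0
  have hs1 : Real.sqrt κ < 1 := by rw [Real.sqrt_lt' one_pos]; simpa
  have hinv : 1 < 1 / Real.sqrt κ := by rwa [lt_div_iff₀ hs, one_mul]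
  obtain ⟨t, ht0, ht⟩ : ∃ t : ℝ, 0 < t ∧ Real.cosh t < 1 / Real.sqrt κ := by
    have h1 : ∀ᶠ t in 𝓝 (0 : ℝ), Real.cosh t < 1 / Real.sqrt κ :=
      Real.continuous_cosh.continuousAt.eventually_lt_const (by simpa using hinv)
    have h2 : ∀ᶠ t in 𝓝[>] (0 : ℝ), 0 < t := self_mem_nhdsWithin
    obtain ⟨t, h, h'⟩ := ((h1.filter_mono nhdsWithin_le_nhds).and h2).exists
    exact ⟨t, h', h⟩
  have hlow : Real.sinh t / t < 1 / Real.sqrt κ :=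
    lt_of_lt_of_le ((div_lt_iff₀ ht0).2 (by linarith [sinh_lt_mul_cosh ht0])) ht.le
  set a := 1 / Real.sqrt κ with ha
  have ha0 : 0 < a := by positivity
  -- The quotient is `sinh a * cosh a / a`, and both factors of the numerator are at least `a`.
  have hhigh : a ≤ Real.sinh (2 * a) / (2 * a) := by
    rw [le_div_iff₀ (by positivity), Real.sinh_two_mul]
    have h1 : a ≤ Real.sinh a := Real.self_le_sinh_iff.2 ha0.le
    have h2 : a ≤ Real.cosh a := h1.trans (Real.sinh_lt_cosh a).le
    nlinarith
  have hcont : ContinuousOn (fun t : ℝ => Real.sinh t / t) (Set.Ioi 0) :=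
    Real.continuous_sinh.continuousOn.div continuousOn_id fun x hx => ne_of_gt hx
  obtain ⟨z, hz0, hz⟩ := isPreconnected_Ioi.intermediate_value (s := Set.Ioi (0 : ℝ)) ht0
    (show (2 * a) ∈ Set.Ioi (0 : ℝ) by simpa using ha0) hcont ⟨hlow.le, hhigh⟩
  have hz0' : (0 : ℝ) < z := hz0
  refine ⟨z, ⟨hz0, ?_⟩, fun w hw => ?_⟩
  · simp only [] at hz
    rw [div_eq_iff hz0'.ne'] at hz
    rw [hz, ha]; ring
  · refine strictMonoOn_sinh_div.injOn hw.1 hz0 ?_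
    simp only [] at hz ⊢
    rw [hz, hw.2, ha]
    have := hw.1.ne'
    field_simp

theorem Y_neg (κ t : ℝ) : Y κ (-t) = -Y κ t := by
  simp only [Y, Real.cosh_neg, Real.sinh_neg, div_neg]
  ring

theorem hasDerivAt_Y (κ : ℝ) {t : ℝ} (ht : t ≠ 0) :
    HasDerivAt (Y κ) (κ / t ^ 2 - 1 / Real.sinh t ^ 2) t := by
  have hs : Real.sinh t ≠ 0 := Real.sinh_ne_zero.2 ht
  refine (((Real.hasDerivAt_cosh t).div (Real.hasDerivAt_sinh t) hs).sub
    ((hasDerivAt_const t κ).div (hasDerivAt_id' t) ht)).congr_deriv ?_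
  have := Real.cosh_sq t
  field_simp
  linear_combination (-t ^ 2) * this

theorem continuousOn_Y (κ : ℝ) : ContinuousOn (Y κ) {0}ᶜ := fun _ ht =>
  (hasDerivAt_Y κ ht).continuousAt.continuousWithinAt

theorem mul_sinh_sq_eq {κ z : ℝ} (hκ0 : 0 < κ) (hz : Real.sinh z = z / Real.sqrt κ) :
    κ * Real.sinh z ^ 2 = z ^ 2 := by
  rw [hz, div_pow, Real.sq_sqrt hκ0.le]
  field_simp

theorem mul_sinh_sq_lt {κ z t : ℝ} (hκ0 : 0 < κ) (hz0 : 0 < z)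
    (hz : Real.sinh z = z / Real.sqrt κ) (ht : 0 < t) (htz : t < z) :
    κ * Real.sinh t ^ 2 < t ^ 2 := by
  have h := strictMonoOn_sinh_div (Set.mem_Ioi.2 ht) (Set.mem_Ioi.2 hz0) htz
  simp only [] at h
  rw [div_lt_div_iff₀ ht hz0] at h
  have h1 := mul_sinh_sq_eq hκ0 hz
  have hst := Real.sinh_pos_iff.2 ht
  have h2 : (Real.sinh t * z) ^ 2 < (Real.sinh z * t) ^ 2 := by gcongr
  have h3 : (κ * Real.sinh t ^ 2) * z ^ 2 < t ^ 2 * z ^ 2 := by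
    nlinarith [mul_lt_mul_of_pos_left h2 hκ0]
  exact lt_of_mul_lt_mul_right h3 (by positivity)

theorem lt_mul_sinh_sq {κ z t : ℝ} (hκ0 : 0 < κ) (hz0 : 0 < z)
    (hz : Real.sinh z = z / Real.sqrt κ) (htz : z < t) :
    t ^ 2 < κ * Real.sinh t ^ 2 := by
  have ht : 0 < t := hz0.trans htz
  have h := strictMonoOn_sinh_div (Set.mem_Ioi.2 hz0) (Set.mem_Ioi.2 ht) htz
  simp only [] at h
  rw [div_lt_div_iff₀ hz0 ht] at h
  have h1 := mul_sinh_sq_eq hκ0 hz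
  have hst := Real.sinh_pos_iff.2 hz0
  have h2 : (Real.sinh z * t) ^ 2 < (Real.sinh t * z) ^ 2 := by gcongr
  have h3 : t ^ 2 * z ^ 2 < (κ * Real.sinh t ^ 2) * z ^ 2 := by
    nlinarith [mul_lt_mul_of_pos_left h2 hκ0]
  exact lt_of_mul_lt_mul_right h3 (by positivity)

theorem strictAntiOn_Y {κ z : ℝ} (hκ0 : 0 < κ) (hz : Real.sinh z = z / Real.sqrt κ) :
    StrictAntiOn (Y κ) (Set.Ioc 0 z) := by
  refine strictAntiOn_of_deriv_neg (convex_Ioc 0 z)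
    ((continuousOn_Y κ).mono fun x hx => hx.1.ne') fun x hx => ?_
  rw [interior_Ioc] at hx
  rw [(hasDerivAt_Y κ hx.1.ne').deriv, sub_neg, div_lt_div_iff₀ (pow_pos hx.1 2)
    (pow_pos (Real.sinh_pos_iff.2 hx.1) 2), one_mul]
  exact mul_sinh_sq_lt hκ0 (hx.1.trans hx.2) hz hx.1 hx.2

theorem strictMonoOn_Y {κ z : ℝ} (hκ0 : 0 < κ) (hz0 : 0 < z)
    (hz : Real.sinh z = z / Real.sqrt κ) : StrictMonoOn (Y κ) (Set.Ici z) := by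
  refine strictMonoOn_of_deriv_pos (convex_Ici z)
    ((continuousOn_Y κ).mono fun x hx => (hz0.trans_le hx).ne') fun x hx => ?_
  rw [interior_Ici] at hx
  have hx0 : 0 < x := hz0.trans hx
  rw [(hasDerivAt_Y κ hx0.ne').deriv, sub_pos, div_lt_div_iff₀
    (pow_pos (Real.sinh_pos_iff.2 hx0) 2) (pow_pos hx0 2), one_mul]
  exact lt_mul_sinh_sq hκ0 hz0 hz hx

theorem Y_min {κ z t : ℝ} (hκ0 : 0 < κ) (hz0 : 0 < z)
    (hz : Real.sinh z = z / Real.sqrt κ) (ht : 0 < t) : Y κ z ≤ Y κ t := by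
  rcases le_total t z with h | h
  · exact (strictAntiOn_Y hκ0 hz).antitoneOn ⟨ht, h⟩ ⟨hz0, le_rfl⟩ h
  · exact (strictMonoOn_Y hκ0 hz0 hz).monotoneOn Set.self_mem_Ici h h

/-- Here `coth t - 1 = exp (-t) / sinh t`, and `exp (-t) sinh t = (1 - exp (-2t)) / 2 < t`. Hence `t
exp (-t) sinh t < t² ≤ κ sinh² t`. This is what lets a value above `1` select the branch `(0, z)`.
-/
theorem Y_lt_one {κ z t : ℝ} (hκ0 : 0 < κ) (hz0 : 0 < z)
    (hz : Real.sinh z = z / Real.sqrt κ) (ht : z ≤ t) : Y κ t < 1 := by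
  have ht0 : 0 < t := hz0.trans_le ht
  have hst := Real.sinh_pos_iff.2 ht0
  have hle : t ^ 2 ≤ κ * Real.sinh t ^ 2 := by
    rcases ht.eq_or_lt with rfl | h
    · exact (mul_sinh_sq_eq hκ0 hz).ge
    · exact (lt_mul_sinh_sq hκ0 hz0 hz h).le
  have hexp : Real.exp (-t) * Real.sinh t < t := by
    rw [Real.sinh_eq, mul_div_assoc', mul_sub, ← Real.exp_add, ← Real.exp_add]
    have := Real.add_one_lt_exp (x := -t + -t) (by linarith)
    simp only [neg_add_cancel, Real.exp_zero]
    linarith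
  have hce : Real.cosh t - Real.sinh t = Real.exp (-t) := Real.cosh_sub_sinh t
  rw [Y, sub_lt_iff_lt_add, div_lt_iff₀ hst]
  have h1 : Real.exp (-t) < κ / t * Real.sinh t := by
    rw [div_mul_eq_mul_div, lt_div_iff₀ ht0]
    have : (Real.exp (-t) * t) * Real.sinh t < (κ * Real.sinh t) * Real.sinh t := by
      nlinarith
    exact lt_of_mul_lt_mul_right this hst.le
  linarith [h1]

theorem Y_critical_pos {κ z : ℝ} (hκ0 : 0 < κ) (hz0 : 0 < z)
    (hz : Real.sinh z = z / Real.sqrt κ) : 0 < Y κ z := by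
  have hst := Real.sinh_pos_iff.2 hz0
  have h1 := mul_sinh_sq_eq hκ0 hz
  have h2 : z < Real.sinh z := Real.self_lt_sinh_iff.2 hz0
  have h3 := Real.one_lt_cosh.2 hz0.ne'
  rw [Y, sub_pos, div_lt_div_iff₀ hz0 hst]
  have : (κ * Real.sinh z) * Real.sinh z < (Real.cosh z * z) * Real.sinh z := by
    nlinarith [mul_pos hz0 hst]
  exact lt_of_mul_lt_mul_right this hst.le

/-- On `(0, z)` the function `Y` takes every value above `Y z`. -/
theorem exists_Y_eq {κ z x : ℝ} (hκ0 : 0 < κ) (hκ1 : κ < 1) (hz0 : 0 < z)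
    (hx : Y κ z < x) : ∃ t, 0 < t ∧ t < z ∧ Y κ t = x := by
  -- A consequence of `tanh t < t`; it makes `Y κ` blow up at `0⁺` and dictates the choice of `t₀`.
  have hlow : ∀ t : ℝ, 0 < t → (1 - κ) / t < Y κ t := fun t ht => by
    rw [Y, sub_div, sub_lt_sub_iff_right, div_lt_div_iff₀ ht (Real.sinh_pos_iff.2 ht), one_mul]
    linarith [sinh_lt_mul_cosh ht]
  set t₀ := min z ((1 - κ) / (|x| + 1)) with ht₀
  have hpos : 0 < (1 - κ) / (|x| + 1) := div_pos (by linarith) (by positivity)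
  have h0 : 0 < t₀ := lt_min hz0 hpos
  have h1 : x ≤ Y κ t₀ := by
    have h2 : |x| + 1 ≤ (1 - κ) / t₀ := by
      rw [le_div_iff₀ h0]
      have := min_le_right z ((1 - κ) / (|x| + 1))
      rw [← ht₀, le_div_iff₀ (by positivity)] at this
      linarith
    linarith [hlow t₀ h0, le_abs_self x]
  obtain ⟨t, ht, hY⟩ := isPreconnected_Ioc.intermediate_value (s := Set.Ioc 0 z)
    (a := z) (b := t₀) ⟨hz0, le_rfl⟩ ⟨h0, min_le_left _ _⟩
    ((continuousOn_Y κ).mono fun x hx => hx.1.ne') ⟨hx.le, h1⟩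
  refine ⟨t, ht.1, lt_of_le_of_ne ht.2 ?_, hY⟩
  rintro rfl
  exact hx.ne hY

theorem strictAntiOn_Y_neg {κ z : ℝ} (hκ0 : 0 < κ) (hz : Real.sinh z = z / Real.sqrt κ) :
    StrictAntiOn (Y κ) (Set.Ioo (-z) 0) := fun a ha b hb hab => by
  have := strictAntiOn_Y hκ0 hz (a := -b) (b := -a) ⟨by linarith [hb.2], by linarith [hb.1]⟩
    ⟨by linarith [ha.2], by linarith [ha.1]⟩ (by linarith)
  rw [Y_neg, Y_neg] at this
  linarith

theorem bijOn_Y {κ z : ℝ} (hκ0 : 0 < κ) (hκ1 : κ < 1) (hz0 : 0 < z)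
    (hz : Real.sinh z = z / Real.sqrt κ) :
    Set.BijOn (Y κ) (Set.Ioo (-z) 0 ∪ Set.Ioo 0 z) (Set.Icc (Y κ (-z)) (Y κ z))ᶜ := by
  have hanti := strictAntiOn_Y hκ0 hz
  have hp := Y_critical_pos hκ0 hz0 hz
  have hright : ∀ t ∈ Set.Ioo 0 z, Y κ z < Y κ t := fun t ht =>
    hanti ⟨ht.1, ht.2.le⟩ ⟨hz0, le_rfl⟩ ht.2
  have hleft : ∀ t ∈ Set.Ioo (-z) 0, Y κ t < -Y κ z := fun t ht => by
    have := hright (-t) ⟨by linarith [ht.2], by linarith [ht.1]⟩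
    rw [Y_neg] at this
    linarith
  rw [Y_neg]
  refine ⟨?_, ?_, ?_⟩
  · rintro t (ht | ht) ⟨h1, h2⟩
    · exact absurd h1 (not_le.2 (hleft t ht))
    · exact absurd h2 (not_le.2 (hright t ht))
  · rintro a (ha | ha) b (hb | hb) hab
    · exact (strictAntiOn_Y_neg hκ0 hz).injOn ha hb hab
    · linarith [hleft a ha, hright b hb]
    · linarith [hleft b hb, hright a ha]
    · exact hanti.injOn ⟨ha.1, ha.2.le⟩ ⟨hb.1, hb.2.le⟩ hab
  · intro x hx
    rw [Set.mem_compl_iff, Set.mem_Icc, not_and_or, not_le, not_le] at hx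
    rcases hx with hx | hx
    · obtain ⟨t, h0, h1, h2⟩ := exists_Y_eq hκ0 hκ1 hz0 (x := -x) (by linarith)
      exact ⟨-t, Or.inl ⟨by linarith, by linarith⟩, by rw [Y_neg, h2, neg_neg]⟩
    · obtain ⟨t, h0, h1, h2⟩ := exists_Y_eq hκ0 hκ1 hz0 hx
      exact ⟨t, Or.inr ⟨h0, h1⟩, h2⟩

/-! ### Logarithmic derivatives of real-rooted polynomials -/

/-- The sum `∑ 1 / (x - r)` over the real roots `r` of `f`. -/
noncomputable def rootSum (f : ℝ[X]) (x : ℝ) : ℝ := (f.roots.map fun r => 1 / (x - r)).sum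

/-- The sum `∑ 1 / (x - r) ^ 2` over the real roots `r` of `f`. -/
noncomputable def rootSqSum (f : ℝ[X]) (x : ℝ) : ℝ := (f.roots.map fun r => 1 / (x - r) ^ 2).sum

/-- Rolle: differentiation loses at most one real zero, which is exactly the drop in degree. -/
theorem splits_derivative {f : ℝ[X]} (hf : f.Splits) : (derivative f).Splits := by
  rw [splits_iff_card_roots]
  refine le_antisymm (card_roots' _) ?_
  have h1 := card_roots_le_derivative f
  rw [← hf.natDegree_eq_card_roots] at h1
  rw [natDegree_derivative]
  omega

theorem eval_ne_zero_of_forall_roots_lt {f : ℝ[X]} (hf0 : f ≠ 0) {x : ℝ}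
    (hx : ∀ r ∈ f.roots, r < x) : f.eval x ≠ 0 := fun h =>
  lt_irrefl x (hx x ((mem_roots hf0).2 h))

theorem eval_derivative_eq {f : ℝ[X]} (hf : f.Splits) {x : ℝ} (hx : f.eval x ≠ 0) :
    (derivative f).eval x = f.eval x * rootSum f x :=
  hf.eval_derivative_eq_eval_mul_sum hx

theorem ne_zero_of_derivative_ne_zero {f : ℝ[X]} (hf : derivative f ≠ 0) : f ≠ 0 := by
  rintro rfl
  simp at hf

theorem hasDerivAt_multiset_sum_inv (s : Multiset ℝ) {x : ℝ} (hx : ∀ r ∈ s, x ≠ r) :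
    HasDerivAt (fun y => (s.map fun r => 1 / (y - r)).sum)
      (-(s.map fun r => 1 / (x - r) ^ 2).sum) x := by
  induction s using Multiset.induction_on with
  | empty => simpa using hasDerivAt_const x (0 : ℝ)
  | cons a s ih =>
    simp only [Multiset.map_cons, Multiset.sum_cons]
    have ha : x - a ≠ 0 := sub_ne_zero.2 (hx a (Multiset.mem_cons_self a s))
    have h1 : HasDerivAt (fun y : ℝ => 1 / (y - a)) (-(1 / (x - a) ^ 2)) x := by
      simpa [one_div, neg_div] using ((hasDerivAt_id' x).sub_const a).fun_inv ha
    rw [neg_add]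
    exact h1.add (ih fun r hr => hx r (Multiset.mem_cons_of_mem hr))

theorem eval_derivative_derivative_eq {f : ℝ[X]} (hf : f.Splits) {x : ℝ} (hx : f.eval x ≠ 0) :
    (derivative (derivative f)).eval x =
      f.eval x * (rootSum f x ^ 2 - rootSqSum f x) := by
  have hf0 : f ≠ 0 := by rintro rfl; simp at hx
  have h1 : HasDerivAt (fun y => (derivative f).eval y)
      ((derivative (derivative f)).eval x) x := (derivative f).hasDerivAt x
  have h2 : HasDerivAt (fun y => f.eval y * rootSum f y)
      ((derivative f).eval x * rootSum f x + f.eval x * -rootSqSum f x) x := by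
    refine (f.hasDerivAt x).mul (hasDerivAt_multiset_sum_inv f.roots fun r hr h => ?_)
    rw [h] at hx
    exact hx ((mem_roots hf0).1 hr)
  have h3 : (fun y => (derivative f).eval y) =ᶠ[𝓝 x] fun y => f.eval y * rootSum f y := by
    filter_upwards [f.continuous.continuousAt.eventually_ne hx] with y hy
    exact eval_derivative_eq hf hy
  rw [h1.unique (h2.congr_of_eventuallyEq h3), eval_derivative_eq hf hx]
  ring

theorem rootSum_pos {f : ℝ[X]} (hcard : f.roots ≠ 0) {x : ℝ} (hx : ∀ r ∈ f.roots, r < x) :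
    0 < rootSum f x := by
  obtain ⟨a, ha⟩ := Multiset.exists_mem_of_ne_zero hcard
  obtain ⟨s, hs⟩ := Multiset.exists_cons_of_mem ha
  rw [rootSum, hs, Multiset.map_cons, Multiset.sum_cons]
  refine add_pos_of_pos_of_nonneg (one_div_pos.2 (sub_pos.2 (hx a ha)))
    (Multiset.sum_nonneg fun u hu => ?_)
  obtain ⟨r, hr, rfl⟩ := Multiset.mem_map.1 hu
  exact (one_div_pos.2 (sub_pos.2 (hx r (hs ▸ Multiset.mem_cons_of_mem hr)))).le

theorem roots_ne_zero_of_derivative {f : ℝ[X]} (hf : f.Splits) (h : derivative f ≠ 0) :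
    f.roots ≠ 0 := by
  intro h0
  have h1 := hf.natDegree_eq_card_roots
  rw [h0, Multiset.card_zero] at h1
  exact h (derivative_of_natDegree_zero h1)

/-- Upper bounds for the roots pass to the derivative. -/
theorem roots_derivative_lt {f : ℝ[X]} (hf : f.Splits) {b : ℝ} (hb : ∀ r ∈ f.roots, r < b) :
    ∀ r ∈ (derivative f).roots, r < b := by
  intro r hr
  by_contra! hbr
  have hd : derivative f ≠ 0 := ne_zero_of_mem_roots hr
  have hf0 : f ≠ 0 := ne_zero_of_derivative_ne_zero hd
  have hlt : ∀ u ∈ f.roots, u < r := fun u hu => (hb u hu).trans_le hbr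
  have hne := eval_ne_zero_of_forall_roots_lt hf0 hlt
  have h1 := eval_derivative_eq hf hne
  rw [(mem_roots hd).1 hr] at h1
  exact mul_ne_zero hne (rootSum_pos (roots_ne_zero_of_derivative hf hd) hlt).ne' h1.symm

/-- This is `f'' / f'` with `f' = f S` and `f'' = f (S² - Q)`. -/
theorem rootSum_derivative {f : ℝ[X]} (hf : f.Splits) (hd : derivative f ≠ 0) {x : ℝ}
    (hx : ∀ r ∈ f.roots, r < x) :
    rootSum (derivative f) x = rootSum f x - rootSqSum f x / rootSum f x := by
  have hf0 : f ≠ 0 := ne_zero_of_derivative_ne_zero hd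
  have hne := eval_ne_zero_of_forall_roots_lt hf0 hx
  have hS := rootSum_pos (roots_ne_zero_of_derivative hf hd) hx
  have hne' := eval_ne_zero_of_forall_roots_lt hd (roots_derivative_lt hf hx)
  have h1 := eval_derivative_eq (splits_derivative hf) hne'
  rw [eval_derivative_derivative_eq hf hne, eval_derivative_eq hf hne, mul_assoc] at h1
  have h2 := mul_left_cancel₀ hne h1
  have := hS.ne'
  field_simp
  linear_combination -h2

/-! ### Barrier argument for the largest zero -/

/-- One step of the barrier argument: differentiation moves an upper barrier `b` at level `φ` of the
logarithmic derivative to the left by at least `1 / φ`. -/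
theorem barrier_step {f : ℝ[X]} (hf : f.Splits) {b φ : ℝ} (hφ : 0 < φ)
    (hb : ∀ r ∈ f.roots, r < b) (hS : rootSum f b ≤ φ) :
    (∀ r ∈ (derivative f).roots, r < b - 1 / φ) ∧ rootSum (derivative f) (b - 1 / φ) ≤ φ := by
  -- If the derivative has no zeros, its sum is empty. Otherwise `f` has at least two zeros, which
  -- makes `1 / (b - r) < φ` strict below.
  by_cases hdeg : (derivative f).roots = 0
  · simp [rootSum, hdeg, hφ.le]
  have hd : derivative f ≠ 0 := by rintro h; simp [h] at hdeg
  have hcard : 2 ≤ Multiset.card f.roots := by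
    rw [← hf.natDegree_eq_card_roots]
    have h1 := (splits_derivative hf).natDegree_eq_card_roots
    rw [natDegree_derivative] at h1
    have := Multiset.card_pos.2 hdeg
    omega
  have hlt : ∀ r ∈ f.roots, r < b - 1 / φ := by
    intro r hr
    obtain ⟨s, hs⟩ := Multiset.exists_cons_of_mem hr
    have hs0 : s ≠ 0 := by
      rintro rfl
      simp [hs] at hcard
    obtain ⟨a, ha⟩ := Multiset.exists_mem_of_ne_zero hs0
    obtain ⟨s', hs'⟩ := Multiset.exists_cons_of_mem ha
    have hpos : ∀ u ∈ f.roots, 0 < 1 / (b - u) := fun u hu =>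
      one_div_pos.2 (sub_pos.2 (hb u hu))
    have h1 : 1 / (b - r) < φ := by
      refine lt_of_lt_of_le ?_ hS
      rw [rootSum, hs, hs', Multiset.map_cons, Multiset.map_cons, Multiset.sum_cons,
        Multiset.sum_cons]
      have h2 : 0 ≤ (s'.map fun r => 1 / (b - r)).sum := Multiset.sum_nonneg fun u hu => by
        obtain ⟨v, hv, rfl⟩ := Multiset.mem_map.1 hu
        exact (hpos v (by rw [hs, hs']; simp [hv])).le
      linarith [hpos a (by rw [hs, hs']; simp)]
    have h3 : 1 / φ < b - r := by
      rw [div_lt_iff₀ (sub_pos.2 (hb r hr))] at h1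
      rw [div_lt_iff₀ hφ]
      linarith
    linarith
  refine ⟨roots_derivative_lt hf hlt, ?_⟩
  rw [rootSum_derivative hf hd hlt]
  set x := b - 1 / φ with hx
  have hS1 : 0 < rootSum f x := rootSum_pos (roots_ne_zero_of_derivative hf hd) hlt
  have hS2 : 0 ≤ rootSqSum f x := Multiset.sum_nonneg fun u hu => by
    obtain ⟨v, hv, rfl⟩ := Multiset.mem_map.1 hu
    positivity
  -- Cauchy–Schwarz in linearised form: with `u = x - r`, each term satisfies `2c/u - c² (u +
  -- 1/φ)/u² ≤ 1/(u + 1/φ)`. Optimising `c` after summation gives `S² ≤ φ S + Q`, which is `S - Q/S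
  -- ≤ φ`.
  have key : ∀ c : ℝ, 2 * c * rootSum f x - c ^ 2 * (rootSum f x + rootSqSum f x / φ) ≤
      rootSum f b := by
    intro c
    have h1 : 2 * c * rootSum f x - c ^ 2 * (rootSum f x + rootSqSum f x / φ) =
        (f.roots.map fun r => (2 * c - c ^ 2) * (1 / (x - r)) -
          c ^ 2 / φ * (1 / (x - r) ^ 2)).sum := by
      rw [Multiset.sum_map_sub, Multiset.sum_map_mul_left, Multiset.sum_map_mul_left, rootSum,
        rootSqSum]
      ring
    rw [h1, rootSum]
    refine Multiset.sum_map_le_sum_map _ _ fun r hr => ?_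
    have hxr : 0 < x - r := sub_pos.2 (hlt r hr)
    have hbr : b - r = (x - r) + 1 / φ := by rw [hx]; ring
    rw [hbr]
    have hδ : 0 < 1 / φ := by positivity
    have e : 1 / (x - r + 1 / φ) - ((2 * c - c ^ 2) * (1 / (x - r)) -
        c ^ 2 / φ * (1 / (x - r) ^ 2)) =
        (x - r - c * (x - r + 1 / φ)) ^ 2 / ((x - r + 1 / φ) * (x - r) ^ 2) := by
      have : x - r + 1 / φ ≠ 0 := by positivity
      have : φ * (x - r) + 1 ≠ 0 := by positivity
      field_simp
      ring
    have : 0 ≤ (x - r - c * (x - r + 1 / φ)) ^ 2 / ((x - r + 1 / φ) * (x - r) ^ 2) := by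
      positivity
    linarith
  set S := rootSum f x
  set Q := rootSqSum f x
  have hD : 0 < S + Q / φ := by positivity
  have h1 := (key (S / (S + Q / φ))).trans hS
  have h2 : 2 * (S / (S + Q / φ)) * S - (S / (S + Q / φ)) ^ 2 * (S + Q / φ) =
      S ^ 2 / (S + Q / φ) := by
    field_simp
    ring
  rw [h2, div_le_iff₀ hD] at h1
  have h3 : S ^ 2 ≤ φ * S + Q := by
    have : φ * (S + Q / φ) = φ * S + Q := by field_simp
    linarith
  rw [sub_le_iff_le_add, ← sub_le_iff_le_add', le_div_iff₀ hS1]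
  nlinarith

theorem splits_iterate_derivative {f : ℝ[X]} (hf : f.Splits) (m : ℕ) :
    (derivative^[m] f).Splits := by
  induction m with
  | zero => exact hf
  | succ m ih => rw [Function.iterate_succ_apply']; exact splits_derivative ih

theorem barrier_iterate {f : ℝ[X]} (hf : f.Splits) {b φ : ℝ} (hφ : 0 < φ)
    (hb : ∀ r ∈ f.roots, r < b) (hS : rootSum f b ≤ φ) (m : ℕ) :
    (∀ r ∈ (derivative^[m] f).roots, r < b - m / φ) ∧
      rootSum (derivative^[m] f) (b - m / φ) ≤ φ := by
  induction m with
  | zero =>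
    rw [Nat.cast_zero, zero_div, sub_zero]
    exact ⟨hb, hS⟩
  | succ m ih =>
    rw [Function.iterate_succ_apply']
    have := barrier_step (splits_iterate_derivative hf m) hφ ih.1 ih.2
    have e : b - ((m + 1 : ℕ) : ℝ) / φ = b - m / φ - 1 / φ := by push_cast; ring
    rwa [e]

theorem roots_iterate_derivative_lt {f : ℝ[X]} (hf : f.Splits) {b : ℝ}
    (hb : ∀ r ∈ f.roots, r < b) (m : ℕ) : ∀ r ∈ (derivative^[m] f).roots, r < b := by
  induction m with
  | zero => exact hb
  | succ m ih =>
    rw [Function.iterate_succ_apply']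
    exact roots_derivative_lt (splits_iterate_derivative hf m) ih

/-! ### Estimates to the right of the zeros -/

section Bounds

variable {f : ℝ[X]} {x x' : ℝ}

theorem rootSum_le (hr : ∀ r ∈ f.roots, r ≤ 1) (hx : 1 < x) :
    rootSum f x ≤ Multiset.card f.roots / (x - 1) := by
  have := Multiset.sum_map_le_sum_map (s := f.roots) (fun r => 1 / (x - r))
    (fun _ => 1 / (x - 1)) fun r h =>
      one_div_le_one_div_of_le (by linarith) (by linarith [hr r h])
  simpa [rootSum, div_eq_mul_inv] using this

theorem le_rootSum (hr : ∀ r ∈ f.roots, r ∈ Set.Icc (-1 : ℝ) 1) (hx : 1 < x) :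
    Multiset.card f.roots / (x + 1) ≤ rootSum f x := by
  have := Multiset.sum_map_le_sum_map (s := f.roots) (fun _ => 1 / (x + 1))
    (fun r => 1 / (x - r)) fun r h =>
      one_div_le_one_div_of_le (by linarith [(hr r h).2]) (by linarith [(hr r h).1])
  simpa [rootSum, div_eq_mul_inv] using this

theorem rootSum_sub_nonneg (hr : ∀ r ∈ f.roots, r ≤ 1) (hx' : 1 < x') (hx : x' ≤ x) :
    0 ≤ rootSum f x' - rootSum f x := by
  rw [sub_nonneg]
  exact Multiset.sum_map_le_sum_map _ _ fun r h =>
    one_div_le_one_div_of_le (by linarith [hr r h]) (by linarith)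

theorem rootSum_sub_le (hr : ∀ r ∈ f.roots, r ≤ 1) (hx' : 1 < x') (hx : x' ≤ x) :
    rootSum f x' - rootSum f x ≤ Multiset.card f.roots * ((x - x') / (x' - 1) ^ 2) := by
  rw [rootSum, rootSum, ← Multiset.sum_map_sub]
  have := Multiset.sum_map_le_sum_map (s := f.roots) (fun r => 1 / (x' - r) - 1 / (x - r))
    (fun _ => (x - x') / (x' - 1) ^ 2) fun r h => by
      have h1 := hr r h
      have h2 : 0 < x' - r := by linarith
      have h3 : 0 < x - r := by linarith
      rw [div_sub_div _ _ h2.ne' h3.ne']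
      have h4 : 0 < x' - 1 := by linarith
      have h5 : 0 ≤ x - x' := by linarith
      have e : 1 * (x - r) - (x' - r) * 1 = x - x' := by ring
      rw [e]
      gcongr
      nlinarith
  simpa using this

theorem rootSqSum_le (hr : ∀ r ∈ f.roots, r ≤ 1) (hx : 1 < x) :
    rootSqSum f x ≤ rootSum f x / (x - 1) := by
  rw [rootSqSum, rootSum, div_eq_mul_inv, mul_comm, ← Multiset.sum_map_mul_left]
  refine Multiset.sum_map_le_sum_map _ _ fun r h => ?_
  have h1 : 0 < x - 1 := by linarith
  have h2 : x - 1 ≤ x - r := by linarith [hr r h]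
  have h3 : 0 < x - r := by linarith
  rw [sq, ← one_div_mul_one_div, ← one_div]
  gcongr

theorem rootSqSum_nonneg : 0 ≤ rootSqSum f x := Multiset.sum_nonneg fun u hu => by
  obtain ⟨v, hv, rfl⟩ := Multiset.mem_map.1 hu
  positivity

/-- The change `Q / S` is bounded independently of the degree, so after division by `n` consecutive
derivatives have the same limit. -/
theorem abs_rootSum_derivative_sub_le (hf : f.Splits) (hd : derivative f ≠ 0)
    (hr : ∀ r ∈ f.roots, r ≤ 1) (hx : 1 < x) :
    |rootSum (derivative f) x - rootSum f x| ≤ 1 / (x - 1) := by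
  have hlt : ∀ r ∈ f.roots, r < x := fun r h => (hr r h).trans_lt hx
  have hS := rootSum_pos (roots_ne_zero_of_derivative hf hd) hlt
  have h1 : 0 < x - 1 := by linarith
  rw [rootSum_derivative hf hd hlt, sub_sub_cancel_left, abs_neg,
    abs_of_nonneg (div_nonneg rootSqSum_nonneg hS.le), div_le_iff₀ hS, one_div_mul_eq_div]
  exact rootSqSum_le hr hx

theorem eval_pos_of_leadingCoeff_pos (hf : f.Splits) (hl : 0 < f.leadingCoeff)
    (hx : ∀ r ∈ f.roots, r < x) : 0 < f.eval x := by
  rw [hf.eval_eq_prod_roots]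
  refine mul_pos hl (Multiset.prod_pos fun u hu => ?_)
  obtain ⟨r, hr, rfl⟩ := Multiset.mem_map.1 hu
  exact sub_pos.2 (hx r hr)

/-- Mean value theorem for `log f`, whose derivative is `rootSum f`. -/
theorem exists_eval_div_eq_exp (hf : f.Splits) (hl : 0 < f.leadingCoeff)
    (hr : ∀ r ∈ f.roots, r ≤ 1) (hx' : 1 < x') (hx : x' < x) :
    ∃ ξ ∈ Set.Ioo x' x, f.eval x' / f.eval x = Real.exp (-(x - x') * rootSum f ξ) := by
  have hpos : ∀ t, x' ≤ t → 0 < f.eval t := fun t ht =>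
    eval_pos_of_leadingCoeff_pos hf hl fun r h => ((hr r h).trans_lt hx').trans_le ht
  have hder : ∀ t, x' ≤ t → HasDerivAt (fun t => Real.log (f.eval t)) (rootSum f t) t := by
    intro t ht
    have := (f.hasDerivAt t).log (hpos t ht).ne'
    rwa [eval_derivative_eq hf (hpos t ht).ne', mul_div_cancel_left₀ _ (hpos t ht).ne'] at this
  obtain ⟨ξ, hξ, h⟩ := exists_hasDerivAt_eq_slope _ (rootSum f) hx
    (fun t ht => (hder t ht.1).continuousAt.continuousWithinAt) fun t ht => hder t ht.1.le
  refine ⟨ξ, hξ, ?_⟩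
  have h1 : 0 < x - x' := by linarith
  rw [eq_div_iff h1.ne'] at h
  have : -(x - x') * rootSum f ξ = Real.log (f.eval x') - Real.log (f.eval x) := by linarith
  rw [this, Real.exp_sub, Real.exp_log (hpos _ le_rfl), Real.exp_log (hpos _ hx.le)]

end Bounds

/-! ### The rescaled polynomial and its difference equation -/

/-- `p_n((z + 1) / 2)`. -/
noncomputable def rescaledPoly (n : ℕ) : ℝ[X] := (equispacedPoly n).comp (C (1 / 2) * (X + 1))

theorem rescaledDeriv_eq (κ : ℝ) (n : ℕ) :
    rescaledDeriv κ n = derivative^[⌊κ * (n : ℝ)⌋₊] (rescaledPoly n) := rfl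

theorem rescaledPoly_eq (n : ℕ) :
    rescaledPoly n = C ((1 / 2) ^ n) * ∏ j ∈ Finset.range n, (X - C (2 * (j : ℝ) / n - 1)) := by
  have h : ∀ j : ℕ, C (1 / 2 : ℝ) * (X + 1) - C ((j : ℝ) / n) =
      C (1 / 2 : ℝ) * (X - C (2 * (j : ℝ) / n - 1)) := fun j => by
    have : (j : ℝ) / n = 1 / 2 * (2 * (j : ℝ) / n) := by ring
    rw [this, C_mul, C_sub, C_1]
    ring
  simp only [rescaledPoly, equispacedPoly, prod_comp, sub_comp, X_comp, C_comp, h,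
    Finset.prod_mul_distrib, Finset.prod_const, Finset.card_range, C_pow]

theorem roots_rescaledPoly (n : ℕ) :
    (rescaledPoly n).roots = (Multiset.range n).map fun j : ℕ => 2 * (j : ℝ) / n - 1 := by
  rw [rescaledPoly_eq, roots_C_mul _ (by positivity), ← Finset.range_val]
  exact roots_multiset_prod_X_sub_C ((Finset.range n).val.map fun j : ℕ => 2 * (j : ℝ) / n - 1) ▸
    by simp [Finset.prod]

theorem splits_rescaledPoly (n : ℕ) : (rescaledPoly n).Splits := by
  rw [rescaledPoly_eq]
  exact (Splits.C _).mul (Splits.prod fun j _ => Splits.X_sub_C _)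

theorem natDegree_rescaledPoly (n : ℕ) : (rescaledPoly n).natDegree = n := by
  rw [(splits_rescaledPoly n).natDegree_eq_card_roots, roots_rescaledPoly]
  simp

theorem leadingCoeff_rescaledPoly_pos (n : ℕ) : 0 < (rescaledPoly n).leadingCoeff := by
  have : (∏ j ∈ Finset.range n, (X - C (2 * (j : ℝ) / n - 1))).Monic :=
    monic_prod_of_monic _ _ fun j _ => monic_X_sub_C _
  rw [rescaledPoly_eq, leadingCoeff_mul, this.leadingCoeff, leadingCoeff_C]
  positivity

theorem natDegree_iterate_derivative_eq (f : ℝ[X]) (m : ℕ) :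
    (derivative^[m] f).natDegree = f.natDegree - m := by
  induction m with
  | zero => rfl
  | succ m ih => rw [Function.iterate_succ_apply', natDegree_derivative, ih]; omega

theorem leadingCoeff_iterate_derivative_pos {f : ℝ[X]} (hf : 0 < f.leadingCoeff) {m : ℕ}
    (hm : m ≤ f.natDegree) : 0 < (derivative^[m] f).leadingCoeff := by
  induction m with
  | zero => exact hf
  | succ m ih =>
    rw [Function.iterate_succ_apply', leadingCoeff_derivative, natDegree_iterate_derivative_eq]
    refine mul_pos (ih (by omega)) ?_
    exact_mod_cast (by omega : 0 < f.natDegree - m)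

theorem roots_rescaledPoly_mem {n : ℕ} {r : ℝ} (hr : r ∈ (rescaledPoly n).roots) :
    -1 ≤ r ∧ r + 2 / n ≤ 1 := by
  rw [roots_rescaledPoly, Multiset.mem_map] at hr
  obtain ⟨j, hj, rfl⟩ := hr
  rw [Multiset.mem_range] at hj
  have hn : (0 : ℝ) < n := by exact_mod_cast (by omega : 0 < n)
  have h1 : (j : ℝ) + 1 ≤ n := by exact_mod_cast hj
  constructor
  · have : 0 ≤ 2 * (j : ℝ) / n := by positivity
    linarith
  · have : 2 * (j : ℝ) / n - 1 + 2 / n = 2 * ((j + 1) / n) - 1 := by ring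
    rw [this]
    have : ((j : ℝ) + 1) / n ≤ 1 := (div_le_one hn).2 h1
    linarith

/-- Up to the factor `2⁻ⁿ`, both sides are the product over the `n + 1` nodes `2j/n - 1`, `0 ≤ j ≤
n`: the factor `X - 1` supplies `j = n` on the left, and `X + 1` supplies `j = 0` on the right. -/
theorem rescaledPoly_shift {n : ℕ} (hn : n ≠ 0) :
    rescaledPoly n * X - rescaledPoly n =
      (rescaledPoly n).comp (X - C (2 / (n : ℝ))) * X +
        (rescaledPoly n).comp (X - C (2 / (n : ℝ))) := by
  have hn' : (n : ℝ) ≠ 0 := by exact_mod_cast hn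
  have h1 : ∀ j : ℕ, X - C (2 / (n : ℝ)) - C (2 * (j : ℝ) / n - 1) =
      X - C (2 * ((j + 1 : ℕ) : ℝ) / n - 1) := fun j => by
    rw [sub_sub, ← C_add]
    congr 2
    push_cast
    ring
  have h2 := Finset.prod_range_succ (fun j : ℕ => (X - C (2 * (j : ℝ) / n - 1) : ℝ[X])) n
  rw [Finset.prod_range_succ', mul_div_assoc 2 (n : ℝ), div_self hn'] at h2
  have e1 : (C (2 * 1 - 1 : ℝ)) = 1 := by rw [← C_1]; norm_num
  have e2 : (C (2 * ((0 : ℕ) : ℝ) / n - 1)) = -1 := by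
    rw [Nat.cast_zero, mul_zero, zero_div, zero_sub, C_neg, C_1]
  rw [e1, e2] at h2
  simp only [rescaledPoly_eq, mul_comp, C_comp, prod_comp, sub_comp, X_comp, h1]
  linear_combination (-C ((1 / 2 : ℝ) ^ n)) * h2

theorem iterate_derivative_comp_X_sub_C (f : ℝ[X]) (c : ℝ) (m : ℕ) :
    derivative^[m] (f.comp (X - C c)) = (derivative^[m] f).comp (X - C c) := by
  induction m with
  | zero => rfl
  | succ m ih => simp [Function.iterate_succ_apply', ih, derivative_comp]

theorem iterate_derivative_comp_C_sub_X (f : ℝ[X]) (c : ℝ) (m : ℕ) :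
    derivative^[m] (f.comp (C c - X)) = (-1) ^ m * (derivative^[m] f).comp (C c - X) := by
  induction m generalizing f with
  | zero => simp
  | succ m ih => simp [ih (derivative f), derivative_comp, pow_succ]

theorem eval_iterate_derivative_shift {n : ℕ} (hn : n ≠ 0) (k : ℕ) (y : ℝ) :
    (y - 1) * (derivative^[k + 1] (rescaledPoly n)).eval y +
        (k + 1) * (derivative^[k] (rescaledPoly n)).eval y =
      (y + 1) * (derivative^[k + 1] (rescaledPoly n)).eval (y - 2 / n) +
        (k + 1) * (derivative^[k] (rescaledPoly n)).eval (y - 2 / n) := by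
  have h := congrArg (fun p : ℝ[X] => (derivative^[k + 1] p).eval y) (rescaledPoly_shift hn)
  simp only [iterate_derivative_sub, iterate_map_add, iterate_derivative_mul_X,
    iterate_derivative_comp_X_sub_C, add_tsub_cancel_right, eval_add, eval_sub, eval_mul, eval_X,
    eval_comp, eval_C, nsmul_eq_mul, eval_natCast] at h
  push_cast at h
  linear_combination h

/-- The zeros of every derivative are symmetric about `-1 / n`. -/
theorem roots_iterate_derivative_symm {n m : ℕ} (hn : n ≠ 0) {r : ℝ}
    (hr : r ∈ (derivative^[m] (rescaledPoly n)).roots) :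
    -(2 / n) - r ∈ (derivative^[m] (rescaledPoly n)).roots := by
  have hn' : (n : ℝ) ≠ 0 := by exact_mod_cast hn
  -- The nodes run from `-1` to `1 - 2/n`; the reflection is the index reversal `j ↦ n - 1 - j`.
  have hs : (rescaledPoly n).comp (C (-(2 / (n : ℝ))) - X) = (-1) ^ n * rescaledPoly n := by
    have h1 : ∀ j ∈ Finset.range n, C (-(2 / (n : ℝ))) - X - C (2 * ((n - 1 - j : ℕ) : ℝ) / n - 1) =
        -1 * (X - C (2 * (j : ℝ) / n - 1)) := fun j hj => by
      have hj' := Finset.mem_range.1 hj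
      have e : ((n - 1 - j : ℕ) : ℝ) = n - 1 - j := by
        rw [Nat.cast_sub (by omega), Nat.cast_sub (by omega)]; simp
      have e2 : 2 * ((n : ℝ) - 1 - j) / n - 1 = -(2 / n) - (2 * (j : ℝ) / n - 1) := by
        field_simp; ring
      rw [e, e2, C_sub]
      ring
    simp only [rescaledPoly_eq, mul_comp, C_comp, prod_comp, sub_comp, X_comp]
    rw [← Finset.prod_range_reflect, Finset.prod_congr rfl h1, Finset.prod_mul_distrib,
      Finset.prod_const, Finset.card_range]
    ring
  have h0 : derivative^[m] (rescaledPoly n) ≠ 0 := ne_zero_of_mem_roots hr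
  rw [mem_roots h0] at hr ⊢
  have h := congrArg (fun p : ℝ[X] => (derivative^[m] p).eval r) hs
  have e : ((-1 : ℝ[X]) ^ n) = C ((-1 : ℝ) ^ n) := by simp
  simp only [iterate_derivative_comp_C_sub_X, e, iterate_derivative_C_mul, eval_mul, eval_C,
    eval_comp, eval_sub, eval_X, eval_pow, eval_neg, eval_one] at h
  rw [IsRoot.def.1 hr, mul_zero] at h
  exact (mul_eq_zero.1 h).resolve_left (pow_ne_zero _ (by norm_num))

/-! ### Location of the zeros of the derivatives -/

/-- Times `2/n`, the sum is a left Riemann sum of the increasing function `r ↦ 1 / (b - r)` on `[-1,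
1]`; `F` is its antiderivative at the nodes. -/
theorem rootSum_rescaledPoly_le {n : ℕ} (hn : n ≠ 0) {b : ℝ} (hb : 1 < b) :
    rootSum (rescaledPoly n) b ≤ n * (Real.log ((b + 1) / (b - 1)) / 2) := by
  have hn' : (0 : ℝ) < n := by positivity
  set F : ℕ → ℝ := fun j => -Real.log (b - (2 * (j : ℝ) / n - 1)) with hF
  have hpos : ∀ j : ℕ, j ≤ n → 0 < b - (2 * (j : ℝ) / n - 1) := fun j hj => by
    have : (j : ℝ) / n ≤ 1 := (div_le_one hn').2 (by exact_mod_cast hj)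
    rw [mul_div_assoc]
    linarith
  have hterm : ∀ j ∈ Finset.range n,
      1 / (b - (2 * (j : ℝ) / n - 1)) ≤ n / 2 * (F (j + 1) - F j) := fun j hj => by
    have hj' := Finset.mem_range.1 hj
    have h1 := hpos j hj'.le
    have h2 := hpos (j + 1) hj'
    have h3 := Real.log_le_sub_one_of_pos (div_pos h2 h1)
    rw [Real.log_div h2.ne' h1.ne'] at h3
    have h4 : (b - (2 * ((j + 1 : ℕ) : ℝ) / n - 1)) / (b - (2 * (j : ℝ) / n - 1)) - 1 =
        -(2 / n) * (1 / (b - (2 * (j : ℝ) / n - 1))) := by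
      rw [div_sub_one h1.ne', mul_one_div]
      congr 1
      push_cast
      ring
    rw [h4] at h3
    have h5 : n / 2 * (2 / n * (1 / (b - (2 * (j : ℝ) / n - 1)))) =
        1 / (b - (2 * (j : ℝ) / n - 1)) := by field_simp
    rw [← h5]
    refine mul_le_mul_of_nonneg_left ?_ (by positivity)
    simp only [hF]
    linarith
  have hsum : rootSum (rescaledPoly n) b =
      ∑ j ∈ Finset.range n, 1 / (b - (2 * (j : ℝ) / n - 1)) := by
    rw [rootSum, roots_rescaledPoly, Multiset.map_map]
    rfl
  rw [hsum]
  refine (Finset.sum_le_sum hterm).trans ?_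
  rw [← Finset.mul_sum, Finset.sum_range_sub]
  have e1 : b - (2 * (n : ℝ) / n - 1) = b - 1 := by
    rw [mul_div_assoc, div_self hn'.ne']; ring
  have e0 : b - (2 * ((0 : ℕ) : ℝ) / n - 1) = b + 1 := by simp
  simp only [hF]
  rw [e1, e0, Real.log_div (by linarith) (by linarith)]
  apply le_of_eq
  ring

/-- For `b = coth t` the logarithm equals `2t`. With level `n t`, `m` barrier steps move `coth t` to
`Y (m/n) t`. -/
theorem rootSum_rescaledPoly_coth_le {n : ℕ} (hn : n ≠ 0) {t : ℝ} (ht : 0 < t) :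
    rootSum (rescaledPoly n) (Real.cosh t / Real.sinh t) ≤ n * t := by
  have hs := Real.sinh_pos_iff.2 ht
  have hb : 1 < Real.cosh t / Real.sinh t := by
    rw [lt_div_iff₀ hs, one_mul]; exact Real.sinh_lt_cosh t
  refine (rootSum_rescaledPoly_le hn hb).trans_eq ?_
  have : (Real.cosh t / Real.sinh t + 1) / (Real.cosh t / Real.sinh t - 1) = Real.exp (2 * t) := by
    rw [div_add_one hs.ne', div_sub_one hs.ne', div_div_div_cancel_right₀ hs.ne',
      Real.cosh_add_sinh, Real.cosh_sub_sinh, ← Real.exp_sub]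
    congr 1
    ring
  rw [this, Real.log_exp]
  ring

/-- All zeros of the `m`-th derivative lie below `coth t - m / (n t)`. -/
theorem roots_iterate_derivative_lt_coth {n : ℕ} (hn : n ≠ 0) (m : ℕ) {t : ℝ} (ht : 0 < t) :
    ∀ r ∈ (derivative^[m] (rescaledPoly n)).roots,
      r < Real.cosh t / Real.sinh t - (m : ℝ) / n / t := by
  have hs := Real.sinh_pos_iff.2 ht
  have hb : 1 < Real.cosh t / Real.sinh t := by
    rw [lt_div_iff₀ hs, one_mul]; exact Real.sinh_lt_cosh t
  have hn' : (0 : ℝ) < n := by positivity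
  rw [div_div]
  refine (barrier_iterate (splits_rescaledPoly n) (by positivity) (fun r hr => ?_)
    (rootSum_rescaledPoly_coth_le hn ht) m).1
  have := (roots_rescaledPoly_mem hr).2
  have : (0 : ℝ) < 2 / n := by positivity
  linarith

theorem roots_iterate_derivative_mem {n : ℕ} (hn : n ≠ 0) (m : ℕ) :
    ∀ r ∈ (derivative^[m] (rescaledPoly n)).roots, r ∈ Set.Icc (-1 : ℝ) 1 := by
  have hn' : (0 : ℝ) < 2 / n := by positivity
  -- The margin `2 / n` matters: reflection about `-1/n` turns this bound into `-1 ≤ r`.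
  have key : ∀ r ∈ (derivative^[m] (rescaledPoly n)).roots, r ≤ 1 - 2 / n := fun r hr => by
    refine le_of_forall_pos_lt_add fun ε hε => ?_
    refine roots_iterate_derivative_lt (splits_rescaledPoly n) (fun u hu => ?_) m r hr
    have := (roots_rescaledPoly_mem hu).2
    linarith
  intro r hr
  have h1 := key r hr
  have h2 := key _ (roots_iterate_derivative_symm hn hr)
  exact ⟨by linarith, by linarith⟩

theorem card_roots_iterate_derivative (n m : ℕ) :
    Multiset.card (derivative^[m] (rescaledPoly n)).roots = n - m := by
  rw [← (splits_iterate_derivative (splits_rescaledPoly n) m).natDegree_eq_card_roots,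
    natDegree_iterate_derivative_eq, natDegree_rescaledPoly]

/-! ### Limit of the logarithmic derivative -/

/-- The difference equation for the derivatives, written in terms of logarithmic derivatives: up to
errors `O(1 / n)` it is an equation for the single quantity `rootSum / n`. -/
theorem exists_approx_equation {n k : ℕ} (hk : k + 1 < n) {y : ℝ} (hy : 2 / (n : ℝ) < y - 1) :
    ∃ v : ℝ × ℝ × ℝ,
      |v.1 - rootSum (derivative^[k + 1] (rescaledPoly n)) y / n| ≤ 1 / (y - 1) / n ∧
      |v.2.1 - v.1| ≤ 2 / n / (y - 2 / n - 1) ^ 2 ∧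
      |v.2.2 - rootSum (derivative^[k + 1] (rescaledPoly n)) y / n| ≤
        2 / n / (y - 2 / n - 1) ^ 2 ∧
      (y - 1) + (k + 1 : ℕ) / n / v.1 =
        Real.exp (-2 * v.2.2) * ((y + 1) + (k + 1 : ℕ) / n / v.2.1) := by
  have hn : n ≠ 0 := by omega
  have hn' : (0 : ℝ) < n := by positivity
  have hh : (0 : ℝ) < 2 / n := by positivity
  set f := derivative^[k] (rescaledPoly n) with hf
  set q := derivative^[k + 1] (rescaledPoly n) with hq
  set x := y - 2 / (n : ℝ) with hx
  have hqf : q = derivative f := Function.iterate_succ_apply' _ _ _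
  have hx1 : 1 < x := by linarith
  have hy1 : 1 < y := by linarith
  have hxy : x < y := by linarith
  have hfs : f.Splits := splits_iterate_derivative (splits_rescaledPoly n) k
  have hqs : q.Splits := splits_iterate_derivative (splits_rescaledPoly n) (k + 1)
  have hfl : 0 < f.leadingCoeff := leadingCoeff_iterate_derivative_pos
    (leadingCoeff_rescaledPoly_pos n) (by rw [natDegree_rescaledPoly]; omega)
  have hql : 0 < q.leadingCoeff := leadingCoeff_iterate_derivative_pos
    (leadingCoeff_rescaledPoly_pos n) (by rw [natDegree_rescaledPoly]; omega)
  have hfr : ∀ r ∈ f.roots, r ≤ 1 := fun r hr => (roots_iterate_derivative_mem hn k r hr).2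
  have hqr : ∀ r ∈ q.roots, r ≤ 1 := fun r hr => (roots_iterate_derivative_mem hn (k + 1) r hr).2
  have hd : derivative f ≠ 0 := by
    rw [← hqf]
    rintro h
    simp [h] at hql
  have hfcard : (Multiset.card f.roots : ℝ) ≤ n := by
    rw [hf, card_roots_iterate_derivative]
    exact_mod_cast Nat.sub_le _ _
  have hqcard : (Multiset.card q.roots : ℝ) ≤ n := by
    rw [hq, card_roots_iterate_derivative]
    exact_mod_cast Nat.sub_le _ _
  have hsub : y - x = 2 / n := by rw [hx]; ring
  have hvar : ∀ p : ℝ[X], (∀ r ∈ p.roots, r ≤ 1) → (Multiset.card p.roots : ℝ) ≤ n →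
      (rootSum p x - rootSum p y) / n ≤ 2 / n / (x - 1) ^ 2 := fun p hr hc => by
    have h1 := rootSum_sub_le hr hx1 hxy.le
    rw [hsub] at h1
    rw [div_le_iff₀ hn', mul_comm]
    exact h1.trans (mul_le_mul_of_nonneg_right hc (by positivity))
  obtain ⟨ξ, hξ, hexp⟩ := exists_eval_div_eq_exp hqs hql hqr hx1 hxy
  -- Since `f / q = 1 / rootSum f` and `q x / q y` is an exact exponential at the mean value point
  -- `ξ`, the relation stays an equality; all errors sit in these three arguments.
  refine ⟨(rootSum f y / n, rootSum f x / n, rootSum q ξ / n), ?_, ?_, ?_, ?_⟩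
  · rw [← sub_div, abs_div, abs_of_pos hn', abs_sub_comm, hqf]
    gcongr
    exact abs_rootSum_derivative_sub_le hfs hd hfr hy1
  · simp only []
    rw [← sub_div, abs_of_nonneg (div_nonneg (rootSum_sub_nonneg hfr hx1 hxy.le) hn'.le)]
    exact hvar f hfr hfcard
  · simp only []
    rw [← sub_div, abs_of_nonneg (div_nonneg
      (rootSum_sub_nonneg hqr (hx1.trans hξ.1) hξ.2.le) hn'.le)]
    refine le_trans ?_ (hvar q hqr hqcard)
    have := rootSum_sub_nonneg hqr hx1 hξ.1.le
    gcongr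
    linarith
  · simp only []
    have hfpos : ∀ u, 1 < u → 0 < f.eval u := fun u hu =>
      eval_pos_of_leadingCoeff_pos hfs hfl fun r hr => (hfr r hr).trans_lt hu
    have hqpos : ∀ u, 1 < u → 0 < q.eval u := fun u hu =>
      eval_pos_of_leadingCoeff_pos hqs hql fun r hr => (hqr r hr).trans_lt hu
    have hrel : ∀ u, 1 < u → ((k + 1 : ℕ) : ℝ) / n / (rootSum f u / n) =
        (k + 1) * f.eval u / q.eval u := fun u hu => by
      have hS : 0 < rootSum f u := rootSum_pos (roots_ne_zero_of_derivative hfs hd)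
        fun r hr => (hfr r hr).trans_lt hu
      have := hfpos u hu
      rw [hqf, eval_derivative_eq hfs (hfpos u hu).ne', div_div_div_cancel_right₀ hn'.ne']
      push_cast
      field_simp
    have hE : Real.exp (-2 * (rootSum q ξ / n)) = q.eval x / q.eval y := by
      rw [hexp, hsub]
      congr 1
      ring
    rw [hrel y hy1, hrel x hx1, hE]
    have h1 := hqpos y hy1
    have h2 := hqpos x hx1
    have h3 := eval_iterate_derivative_shift hn k y
    rw [← hx, ← hf, ← hq] at h3
    field_simp
    linear_combination h3

theorem eq_of_Y_eq {κ t t' : ℝ} (hκ0 : 0 < κ) (hκ1 : κ < 1) (ht : 0 < t) (ht' : 0 < t')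
    (h1 : 1 < Y κ t) (h : Y κ t' = Y κ t) : t' = t := by
  obtain ⟨z, ⟨hz0, hz⟩, -⟩ := existsUnique_critical hκ0 hκ1
  have key : ∀ u, 1 < Y κ u → u ≤ z := fun u hu => by
    by_contra! hlt
    exact hu.not_gt (Y_lt_one hκ0 hz0 hz hlt.le)
  exact (strictAntiOn_Y hκ0 hz).injOn ⟨ht', key t' (h ▸ h1)⟩ ⟨ht, key t h1⟩ h

/-- Multiplication by `exp g / 2` gives `cosh g = (y + κ / g) sinh g`. -/
theorem Y_eq_of_exp_eq {κ g y : ℝ} (hg : 0 < g)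
    (h : (y - 1) + κ / g = Real.exp (-2 * g) * ((y + 1) + κ / g)) : Y κ g = y := by
  have hs := Real.sinh_pos_iff.2 hg
  have he : Real.exp (-2 * g) = Real.exp (-g) * Real.exp (-g) := by
    rw [← Real.exp_add]; congr 1; ring
  have h1 : Real.exp g * Real.exp (-g) = 1 := by rw [← Real.exp_add]; simp
  rw [he] at h
  have h2 : Real.cosh g = (y + κ / g) * Real.sinh g := by
    rw [Real.cosh_eq, Real.sinh_eq]
    linear_combination (-Real.exp g / 2) * h +
      (1 / 2) * (-(y + 1 + κ / g) * Real.exp (-g)) * h1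
  rw [Y, h2, mul_div_cancel_right₀ _ hs.ne']
  ring

theorem floor_le_mul {κ : ℝ} (hκ0 : 0 < κ) (n : ℕ) : (⌊κ * (n : ℝ)⌋₊ : ℝ) ≤ κ * n :=
  Nat.floor_le (by positivity)

theorem floor_lt {κ : ℝ} (hκ0 : 0 < κ) (hκ1 : κ < 1) {n : ℕ} (hn : n ≠ 0) :
    ⌊κ * (n : ℝ)⌋₊ < n := by
  have hn' : (0 : ℝ) < n := by positivity
  have := floor_le_mul hκ0 n
  exact_mod_cast (show (⌊κ * (n : ℝ)⌋₊ : ℝ) < n by nlinarith)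

theorem tendsto_floor_div {κ : ℝ} (hκ0 : 0 < κ) :
    Tendsto (fun n : ℕ => (⌊κ * (n : ℝ)⌋₊ : ℝ) / n) atTop (𝓝 κ) :=
  (tendsto_nat_floor_mul_div_atTop hκ0.le).comp tendsto_natCast_atTop_atTop

theorem tendsto_rootSum {κ t : ℝ} (hκ0 : 0 < κ) (hκ1 : κ < 1) (ht : 0 < t) (hY : 1 < Y κ t) :
    Tendsto (fun n : ℕ => rootSum (rescaledDeriv κ n) (Y κ t) / n) atTop (𝓝 t) := by
  set y := Y κ t with hy
  have hinv : Tendsto (fun n : ℕ => 2 / (n : ℝ)) atTop (𝓝 0) :=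
    tendsto_const_div_atTop_nhds_zero_nat 2
  have hev : ∀ᶠ n : ℕ in atTop, ∃ v : ℝ × ℝ × ℝ,
      |v.1 - rootSum (rescaledDeriv κ n) y / n| ≤ 1 / (y - 1) / n ∧
      |v.2.1 - v.1| ≤ 2 / n / (y - 2 / n - 1) ^ 2 ∧
      |v.2.2 - rootSum (rescaledDeriv κ n) y / n| ≤ 2 / n / (y - 2 / n - 1) ^ 2 ∧
      (y - 1) + (⌊κ * (n : ℝ)⌋₊ : ℝ) / n / v.1 =
        Real.exp (-2 * v.2.2) * ((y + 1) + (⌊κ * (n : ℝ)⌋₊ : ℝ) / n / v.2.1) := by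
    filter_upwards [hinv.eventually_lt_const (show (0 : ℝ) < y - 1 by linarith),
      (tendsto_floor_div hκ0).eventually_const_lt hκ0, eventually_ne_atTop 0] with n h1 h2 h3
    have hm : ⌊κ * (n : ℝ)⌋₊ ≠ 0 := fun h => by simp [h] at h2
    obtain ⟨k, hk⟩ := Nat.exists_eq_succ_of_ne_zero hm
    have hlt := floor_lt hκ0 hκ1 h3
    rw [rescaledDeriv_eq, hk] at *
    exact exists_approx_equation hlt h1
  obtain ⟨v, hv⟩ := Filter.skolem.1 hev
  have he1 : Tendsto (fun n : ℕ => 1 / (y - 1) / (n : ℝ)) atTop (𝓝 0) :=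
    tendsto_const_div_atTop_nhds_zero_nat _
  have he2 : Tendsto (fun n : ℕ => 2 / (n : ℝ) / (y - 2 / n - 1) ^ 2) atTop (𝓝 0) := by
    have h : Tendsto (fun n : ℕ => (y - 2 / (n : ℝ) - 1) ^ 2) atTop (𝓝 ((y - 0 - 1) ^ 2)) :=
      ((hinv.const_sub y).sub_const 1).pow 2
    have := hinv.div h (by have : 0 < y - 1 := by linarith
                           rw [sub_zero]; positivity)
    rw [zero_div] at this
    exact this
  -- The upper bound gives compactness; the positive lower bound keeps limits away from `0`, since
  -- the limit equation divides by `g`.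
  have hbound : ∀ᶠ n : ℕ in atTop, rootSum (rescaledDeriv κ n) y / n ∈
      Set.Icc ((1 - κ) / (y + 1)) (1 / (y - 1)) := by
    filter_upwards [eventually_ne_atTop 0] with n hn
    have hn' : (0 : ℝ) < n := by positivity
    have hr := roots_iterate_derivative_mem hn ⌊κ * (n : ℝ)⌋₊
    have hc := card_roots_iterate_derivative n ⌊κ * (n : ℝ)⌋₊
    have hc' : (Multiset.card (rescaledDeriv κ n).roots : ℝ) = n - ⌊κ * (n : ℝ)⌋₊ := by
      rw [rescaledDeriv_eq, hc, Nat.cast_sub (floor_lt hκ0 hκ1 hn).le]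
    have hm := floor_le_mul hκ0 n
    have hm0 : (0 : ℝ) ≤ ⌊κ * (n : ℝ)⌋₊ := by positivity
    have hy1 : 0 < y - 1 := by linarith
    have hy2 : 0 < y + 1 := by linarith
    constructor
    · rw [le_div_iff₀ hn', div_mul_eq_mul_div]
      refine le_trans ?_ (le_rootSum hr hY)
      rw [hc']
      gcongr
      linarith
    · rw [div_le_iff₀ hn', one_div_mul_eq_div]
      refine (rootSum_le (fun r h => (hr r h).2) hY).trans ?_
      rw [← rescaledDeriv_eq, hc']
      gcongr
      linarith
  -- Along any ultrafilter the bounded sequence has a limit `g`, and the limit equation forces `g =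
  -- t`.
  rw [tendsto_iff_ultrafilter]
  intro U hU
  obtain ⟨g, hg, hlim⟩ := isCompact_Icc.ultrafilter_le_nhds
    (U.map fun n : ℕ => rootSum (rescaledDeriv κ n) y / n) (le_principal_iff.2 (hU hbound))
  replace hlim : Tendsto (fun n : ℕ => rootSum (rescaledDeriv κ n) y / n) U (𝓝 g) := hlim
  have hg0 : 0 < g := lt_of_lt_of_le (div_pos (by linarith) (by linarith)) hg.1
  have hv1 : Tendsto (fun n => (v n).1) U (𝓝 g) := by
    have : Tendsto (fun n : ℕ => (v n).1 - rootSum (rescaledDeriv κ n) y / n) U (𝓝 0) :=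
      squeeze_zero_norm' (hU (hv.mono fun n h => h.1)) (he1.mono_left hU)
    simpa using this.add hlim
  have hv2 : Tendsto (fun n => (v n).2.1) U (𝓝 g) := by
    have : Tendsto (fun n : ℕ => (v n).2.1 - (v n).1) U (𝓝 0) :=
      squeeze_zero_norm' (hU (hv.mono fun n h => h.2.1)) (he2.mono_left hU)
    simpa using this.add hv1
  have hv3 : Tendsto (fun n => (v n).2.2) U (𝓝 g) := by
    have : Tendsto (fun n : ℕ => (v n).2.2 - rootSum (rescaledDeriv κ n) y / n) U (𝓝 0) :=
      squeeze_zero_norm' (hU (hv.mono fun n h => h.2.2.1)) (he2.mono_left hU)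
    simpa using this.add hlim
  have hm := (tendsto_floor_div hκ0).mono_left hU
  have hL := (hm.div hv1 hg0.ne').const_add (y - 1)
  have hR := (Real.continuous_exp.continuousAt.tendsto.comp (hv3.const_mul (-2))).mul
    ((hm.div hv2 hg0.ne').const_add (y + 1))
  have heq := tendsto_nhds_unique_of_eventuallyEq hL hR (hU (hv.mono fun n h => h.2.2.2))
  have := eq_of_Y_eq hκ0 hκ1 ht hg0 hY (Y_eq_of_exp_eq hg0 heq)
  rwa [this] at hlim

/-! ### Measures determined by their Stieltjes transform -/

theorem ae_mem_of_measure_compl {α : Type*} [MeasurableSpace α] {ν : Measure α} {s : Set α}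
    (h : ν sᶜ = 0) : ∀ᵐ x ∂ν, x ∈ s := h

theorem integrable_of_continuousOn_Icc {E : Type*} [NormedAddCommGroup E] {ν : Measure ℝ}
    [IsFiniteMeasure ν] {a b : ℝ} (h : ν (Set.Icc a b)ᶜ = 0) {f : ℝ → E}
    (hf : ContinuousOn f (Set.Icc a b)) : Integrable f ν := by
  have h1 : IntegrableOn f (Set.Icc a b) ν := hf.integrableOn_compact isCompact_Icc
  rwa [IntegrableOn, Measure.restrict_eq_self_of_ae_mem (ae_mem_of_measure_compl h)] at h1

section Uniqueness

variable {ν₁ ν₂ : Measure ℝ} [IsFiniteMeasure ν₁] [IsFiniteMeasure ν₂]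

theorem continuousOn_pow_div_sub {j : ℕ} {y : ℝ} (hy : 1 < y) :
    ContinuousOn (fun x : ℝ => x ^ j / (y - x)) (Set.Icc (-1) 1) :=
  (continuous_pow j).continuousOn.div (continuous_const.sub continuous_id).continuousOn
    fun x hx h => by
      have h1 : y - x = 0 := h
      linarith [hx.2]

theorem abs_integral_pow_div_sub_le {ν : Measure ℝ} [IsFiniteMeasure ν]
    (h : ν (Set.Icc (-1) 1)ᶜ = 0) (j : ℕ) {y : ℝ} (hy : 1 < y) :
    |∫ x, x ^ j / (y - x) ∂ν| ≤ 1 / (y - 1) * ν.real Set.univ := by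
  rw [← Real.norm_eq_abs]
  refine norm_integral_le_of_norm_le_const ((ae_mem_of_measure_compl h).mono fun x hx => ?_)
  have h1 : 0 < y - x := by linarith [hx.2]
  have h2 : |x| ≤ 1 := abs_le.2 hx
  rw [norm_div, norm_pow, Real.norm_eq_abs, Real.norm_eq_abs, abs_of_pos h1]
  have : 0 < y - 1 := by linarith
  gcongr
  · exact pow_le_one₀ (abs_nonneg _) h2
  · exact hx.2

/-- Induction through `x^(j+1)/(y-x) = y x^j/(y-x) - x^j`. If the transforms weighted by `x^j`
agree, the difference of the `j`-th moments is a difference of two `O(1/y)` terms, hence zero; the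
identity then passes agreement on to `j + 1`. -/
theorem integral_pow_eq_of_stieltjes_eq (h₁ : ν₁ (Set.Icc (-1) 1)ᶜ = 0)
    (h₂ : ν₂ (Set.Icc (-1) 1)ᶜ = 0)
    (h : ∀ y : ℝ, 1 < y → ∫ x, 1 / (y - x) ∂ν₁ = ∫ x, 1 / (y - x) ∂ν₂) (j : ℕ) :
    ∫ x, x ^ j ∂ν₁ = ∫ x, x ^ j ∂ν₂ := by
  have hstep : ∀ (ν : Measure ℝ) [IsFiniteMeasure ν], ν (Set.Icc (-1) 1)ᶜ = 0 → ∀ (j : ℕ) (y : ℝ),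
      1 < y → ∫ x, x ^ (j + 1) / (y - x) ∂ν = y * ∫ x, x ^ j / (y - x) ∂ν - ∫ x, x ^ j ∂ν := by
    intro ν _ hν j y hy
    rw [← integral_const_mul, ← integral_sub
      ((integrable_of_continuousOn_Icc hν (continuousOn_pow_div_sub hy)).const_mul y)
      (integrable_of_continuousOn_Icc hν (continuous_pow j).continuousOn)]
    refine integral_congr_ae ((ae_mem_of_measure_compl hν).mono fun x hx => ?_)
    have h1 : y - x ≠ 0 := by have := hx.2; intro h; linarith
    simp only []
    field_simp
    ring
  have hmom : ∀ j : ℕ, (∀ y : ℝ, 1 < y → ∫ x, x ^ j / (y - x) ∂ν₁ = ∫ x, x ^ j / (y - x) ∂ν₂) →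
      ∫ x, x ^ j ∂ν₁ = ∫ x, x ^ j ∂ν₂ := by
    intro j hj
    set M := ν₁.real Set.univ + ν₂.real Set.univ
    have hb : ∀ y : ℝ, 1 < y → |∫ x, x ^ j ∂ν₁ - ∫ x, x ^ j ∂ν₂| ≤ 1 / (y - 1) * M := by
      intro y hy
      have e1 := hstep ν₁ h₁ j y hy
      have e2 := hstep ν₂ h₂ j y hy
      rw [hj y hy] at e1
      have b1 := abs_integral_pow_div_sub_le h₁ (j + 1) hy
      have b2 := abs_integral_pow_div_sub_le h₂ (j + 1) hy
      have e : ∫ x, x ^ j ∂ν₁ - ∫ x, x ^ j ∂ν₂ =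
          ∫ x, x ^ (j + 1) / (y - x) ∂ν₂ - ∫ x, x ^ (j + 1) / (y - x) ∂ν₁ := by
        rw [e1, e2]; ring
      rw [e]
      refine (abs_sub _ _).trans ?_
      rw [mul_add]
      linarith
    have hlim : Tendsto (fun y : ℝ => 1 / (y - 1) * M) atTop (𝓝 0) := by
      have : Tendsto (fun y : ℝ => 1 / (y - 1)) atTop (𝓝 0) := by
        simp only [one_div]
        exact tendsto_inv_atTop_zero.comp (tendsto_atTop_add_const_right _ (-1) tendsto_id)
      simpa using this.mul_const M
    have := ge_of_tendsto hlim ((eventually_gt_atTop 1).mono hb)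
    exact sub_eq_zero.1 (abs_nonpos_iff.1 this)
  have hall : ∀ y : ℝ, 1 < y → ∫ x, x ^ j / (y - x) ∂ν₁ = ∫ x, x ^ j / (y - x) ∂ν₂ := by
    induction j with
    | zero => simpa using h
    | succ j ih =>
      intro y hy
      rw [hstep ν₁ h₁ j y hy, hstep ν₂ h₂ j y hy, ih y hy, hmom j ih]
  exact hmom j hall

/-- A finite measure on `[-1, 1]` is determined by its Stieltjes transform on `(1, ∞)`. -/
theorem measure_eq_of_stieltjes_eq (h₁ : ν₁ (Set.Icc (-1) 1)ᶜ = 0)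
    (h₂ : ν₂ (Set.Icc (-1) 1)ᶜ = 0)
    (h : ∀ y : ℝ, 1 < y → ∫ x, 1 / (y - x) ∂ν₁ = ∫ x, 1 / (y - x) ∂ν₂) : ν₁ = ν₂ := by
  have hmom := integral_pow_eq_of_stieltjes_eq h₁ h₂ h
  have hpoly : ∀ p : ℝ[X], ∫ x, p.eval x ∂ν₁ = ∫ x, p.eval x ∂ν₂ := by
    intro p
    simp only [eval_eq_sum_range]
    rw [integral_finsetSum, integral_finsetSum]
    · simp only [integral_const_mul, hmom]
    · exact fun i _ => (integrable_of_continuousOn_Icc h₂ (continuous_pow i).continuousOn).const_mul _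
    · exact fun i _ => (integrable_of_continuousOn_Icc h₁ (continuous_pow i).continuousOn).const_mul _
  -- Weierstrass approximation on `[-1, 1]` passes from polynomials to bounded continuous functions.
  refine ext_of_forall_integral_eq_of_IsFiniteMeasure fun f => ?_
  have happrox : ∀ (ν : Measure ℝ) [IsFiniteMeasure ν], ν (Set.Icc (-1) 1)ᶜ = 0 →
      ∀ (p : ℝ[X]) (ε : ℝ), (∀ x ∈ Set.Icc (-1 : ℝ) 1, |p.eval x - f x| < ε) →
      |∫ x, p.eval x ∂ν - ∫ x, f x ∂ν| ≤ ε * ν.real Set.univ := by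
    intro ν _ hν p ε hp
    rw [← integral_sub (integrable_of_continuousOn_Icc hν p.continuous.continuousOn)
      (integrable_of_continuousOn_Icc hν f.continuous.continuousOn)]
    rw [← Real.norm_eq_abs]
    exact norm_integral_le_of_norm_le_const
      ((ae_mem_of_measure_compl hν).mono fun x hx => (hp x hx).le)
  set M := ν₁.real Set.univ + ν₂.real Set.univ
  have hb : ∀ ε : ℝ, 0 < ε → |∫ x, f x ∂ν₁ - ∫ x, f x ∂ν₂| ≤ ε * M := by
    intro ε hε
    obtain ⟨p, hp⟩ := exists_polynomial_near_of_continuousOn (-1) 1 f f.continuous.continuousOn ε hε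
    have b1 := happrox ν₁ h₁ p ε hp
    have b2 := happrox ν₂ h₂ p ε hp
    rw [abs_le] at b1 b2 ⊢
    rw [hpoly p] at b1
    rw [mul_add]
    constructor <;> linarith [b1.1, b1.2, b2.1, b2.2]
  have hlim : Tendsto (fun ε : ℝ => ε * M) (𝓝[>] 0) (𝓝 0) := by
    have : Tendsto (fun ε : ℝ => ε * M) (𝓝 0) (𝓝 (0 * M)) := tendsto_id.mul_const M
    rw [zero_mul] at this
    exact this.mono_left nhdsWithin_le_nhds
  have := ge_of_tendsto hlim (eventually_nhdsWithin_of_forall hb)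
  exact sub_eq_zero.1 (abs_nonpos_iff.1 this)

end Uniqueness

/-! ### Convergence of the real zero distributions -/

/-- The normalised counting measure of the real zeros of `f`. -/
noncomputable def realDist (n : ℕ) (f : ℝ[X]) : FiniteMeasure ℝ :=
  (n : ℝ≥0)⁻¹ • (f.roots.map fun r : ℝ => (diracProba r).toFiniteMeasure).sum

theorem toMeasure_diracProba {α : Type*} [MeasurableSpace α] (a : α) :
    ((diracProba a).toFiniteMeasure : Measure α) = Measure.dirac a := rfl

theorem sum_dirac_apply {α : Type*} [MeasurableSpace α] (s : Multiset α) {B : Set α}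
    (hB : MeasurableSet B) (h : ∀ r ∈ s, r ∈ B) :
    (s.map fun r : α => (diracProba r).toFiniteMeasure).sum Bᶜ = 0 := by
  induction s using Multiset.induction_on with
  | empty => simp
  | cons a s ih =>
    rw [Multiset.map_cons, Multiset.sum_cons, FiniteMeasure.coeFn_add, Pi.add_apply,
      ih fun r hr => h r (Multiset.mem_cons_of_mem hr), add_zero]
    have ha := h a (Multiset.mem_cons_self a s)
    rw [FiniteMeasure.null_iff_toMeasure_null, toMeasure_diracProba]
    simp [Measure.dirac_apply' _ hB.compl, ha]

theorem sum_dirac_univ {α : Type*} [MeasurableSpace α] (s : Multiset α) :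
    (s.map fun r : α => (diracProba r).toFiniteMeasure).sum Set.univ = Multiset.card s := by
  induction s using Multiset.induction_on with
  | empty => simp
  | cons a s ih =>
    rw [Multiset.map_cons, Multiset.sum_cons, FiniteMeasure.coeFn_add, Pi.add_apply, ih]
    simp [add_comm]

theorem integral_sum_dirac (s : Multiset ℝ) (h : BoundedContinuousFunction ℝ ℝ) :
    ∫ x, h x ∂((s.map fun r : ℝ => (diracProba r).toFiniteMeasure).sum : FiniteMeasure ℝ) =
      (s.map h).sum := by
  induction s using Multiset.induction_on with
  | empty => simp
  | cons a s ih =>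
    rw [Multiset.map_cons, Multiset.sum_cons, FiniteMeasure.toMeasure_add,
      integral_add_measure (h.integrable _) (h.integrable _), ih, Multiset.map_cons,
      Multiset.sum_cons, toMeasure_diracProba, integral_dirac]

theorem realDist_mass (n : ℕ) (f : ℝ[X]) :
    (realDist n f).mass = (n : ℝ≥0)⁻¹ * Multiset.card f.roots := by
  rw [realDist, FiniteMeasure.mass, FiniteMeasure.coeFn_smul, Pi.smul_apply, sum_dirac_univ,
    smul_eq_mul]

theorem realDist_compl (n : ℕ) {f : ℝ[X]} {B : Set ℝ} (hB : MeasurableSet B)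
    (h : ∀ r ∈ f.roots, r ∈ B) : realDist n f Bᶜ = 0 := by
  rw [realDist, FiniteMeasure.coeFn_smul, Pi.smul_apply, sum_dirac_apply _ hB h, smul_zero]

/-- The function `x ↦ 1 / (y - x)` on `[-1, 1]`, extended to a bounded continuous function. -/
noncomputable def stieltjesKernel (y : ℝ) (hy : 1 < y) : BoundedContinuousFunction ℝ ℝ :=
  BoundedContinuousFunction.ofNormedAddCommGroup (fun x => 1 / (y - max (-1) (min 1 x)))
    (continuous_const.div (by fun_prop) fun x => by
      have : max (-1) (min 1 x) ≤ 1 := max_le (by norm_num) (min_le_left _ _)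
      intro h
      linarith)
    (1 / (y - 1)) fun x => by
      have : max (-1) (min 1 x) ≤ 1 := max_le (by norm_num) (min_le_left _ _)
      have h1 : 0 < y - max (-1) (min 1 x) := by linarith
      rw [norm_div, norm_one, Real.norm_of_nonneg h1.le]
      exact one_div_le_one_div_of_le (by linarith) (by linarith)

theorem stieltjesKernel_apply {y : ℝ} (hy : 1 < y) {x : ℝ} (hx : x ∈ Set.Icc (-1 : ℝ) 1) :
    stieltjesKernel y hy x = 1 / (y - x) := by
  change 1 / (y - max (-1) (min 1 x)) = _
  rw [min_eq_right hx.2, max_eq_right hx.1]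

theorem integral_stieltjesKernel {ν : Measure ℝ} (hν : ν (Set.Icc (-1) 1)ᶜ = 0) {y : ℝ}
    (hy : 1 < y) : ∫ x, stieltjesKernel y hy x ∂ν = ∫ x, 1 / (y - x) ∂ν :=
  integral_congr_ae ((ae_mem_of_measure_compl hν).mono fun _ hx => stieltjesKernel_apply hy hx)

theorem integral_realDist (n : ℕ) {f : ℝ[X]} (hf : ∀ r ∈ f.roots, r ∈ Set.Icc (-1 : ℝ) 1)
    {y : ℝ} (hy : 1 < y) :
    ∫ x, stieltjesKernel y hy x ∂(realDist n f : Measure ℝ) = rootSum f y / n := by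
  rw [realDist, FiniteMeasure.toMeasure_smul]
  change ∫ x, stieltjesKernel y hy x ∂((n : ℝ≥0)⁻¹ •
    (((f.roots.map fun r : ℝ => (diracProba r).toFiniteMeasure).sum : FiniteMeasure ℝ) :
      Measure ℝ)) = _
  rw [integral_smul_nnreal_measure, integral_sum_dirac, rootSum,
    Multiset.map_congr rfl fun r hr => stieltjesKernel_apply hy (hf r hr), NNReal.smul_def,
    smul_eq_mul, div_eq_inv_mul]
  simp

/-- The barrier bound at the parameter `z`; the near-symmetry of the zeros gives the left endpoint
at a cost of `2 / n`. -/
theorem eventually_roots_mem {κ z δ : ℝ} (hκ0 : 0 < κ) (hz0 : 0 < z) (hδ : 0 < δ) :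
    ∀ᶠ n : ℕ in atTop, ∀ r ∈ (rescaledDeriv κ n).roots,
      r ∈ Set.Icc (-(Y κ z + δ)) (Y κ z + δ) := by
  have h1 : Tendsto (fun n : ℕ => Real.cosh z / Real.sinh z - (⌊κ * (n : ℝ)⌋₊ : ℝ) / n / z)
      atTop (𝓝 (Y κ z)) := ((tendsto_floor_div hκ0).div_const z).const_sub _
  have h2 : Tendsto (fun n : ℕ => 2 / (n : ℝ) +
      (Real.cosh z / Real.sinh z - (⌊κ * (n : ℝ)⌋₊ : ℝ) / n / z)) atTop (𝓝 (0 + Y κ z)) :=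
    (tendsto_const_div_atTop_nhds_zero_nat 2).add h1
  filter_upwards [h2.eventually_lt_const (show 0 + Y κ z < Y κ z + δ by linarith),
    eventually_ne_atTop 0] with n h3 hn r hr
  have hb := roots_iterate_derivative_lt_coth hn ⌊κ * (n : ℝ)⌋₊ hz0
  have b1 := hb r hr
  have b2 := hb _ (roots_iterate_derivative_symm hn hr)
  have : (0 : ℝ) < 2 / n := by positivity
  exact ⟨by linarith, by linarith⟩

theorem exists_limit {κ z : ℝ} (hκ0 : 0 < κ) (hκ1 : κ < 1) (hz0 : 0 < z)
    (hz : Real.sinh z = z / Real.sqrt κ) :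
    ∃ ν : FiniteMeasure ℝ,
      Tendsto (fun n : ℕ => realDist n (rescaledDeriv κ n)) atTop (𝓝 ν) ∧
      (ν : Measure ℝ) (Set.Icc (-Y κ z) (Y κ z))ᶜ = 0 ∧
      (ν.mass : ℝ) = 1 - κ ∧
      ∀ t : ℝ, 0 < t → 1 < Y κ t → ∫ x, 1 / (Y κ t - x) ∂(ν : Measure ℝ) = t := by
  set u : ℕ → FiniteMeasure ℝ := fun n => realDist n (rescaledDeriv κ n) with hu
  have hK : ∀ c : ℝ, IsCompact {μ : FiniteMeasure ℝ | μ.mass ≤ 1 ∧ μ (Set.Icc (-c) c)ᶜ = 0} :=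
    fun c => isCompact_setOfPred_finiteMeasure_le_of_isCompact 1 isCompact_Icc
  have hmass : ∀ n : ℕ, n ≠ 0 → ((u n).mass : ℝ) = 1 - (⌊κ * (n : ℝ)⌋₊ : ℝ) / n := fun n hn => by
    have hn' : (n : ℝ) ≠ 0 := by exact_mod_cast hn
    rw [hu, realDist_mass, rescaledDeriv_eq, card_roots_iterate_derivative, NNReal.coe_mul,
      NNReal.coe_inv, NNReal.coe_natCast, NNReal.coe_natCast,
      Nat.cast_sub (floor_lt hκ0 hκ1 hn).le]
    field_simp
  have hmass1 : ∀ n : ℕ, n ≠ 0 → (u n).mass ≤ 1 := fun n hn => by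
    rw [← NNReal.coe_le_coe, hmass n hn, NNReal.coe_one]
    have : 0 ≤ (⌊κ * (n : ℝ)⌋₊ : ℝ) / n := by positivity
    linarith
  have hroots : ∀ n : ℕ, n ≠ 0 → ∀ r ∈ (rescaledDeriv κ n).roots, r ∈ Set.Icc (-1 : ℝ) 1 :=
    fun n hn => roots_iterate_derivative_mem hn _
  have hmem : ∀ᶠ n in atTop, u n ∈ {μ : FiniteMeasure ℝ | μ.mass ≤ 1 ∧ μ (Set.Icc (-1) 1)ᶜ = 0} := by
    filter_upwards [eventually_ne_atTop 0] with n hn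
    exact ⟨hmass1 n hn, realDist_compl n measurableSet_Icc (hroots n hn)⟩
  have hcluster : ∀ ν : FiniteMeasure ℝ, ν (Set.Icc (-1) 1)ᶜ = 0 → MapClusterPt ν atTop u →
      ∀ t : ℝ, 0 < t → 1 < Y κ t → ∫ x, 1 / (Y κ t - x) ∂(ν : Measure ℝ) = t := by
    intro ν hν hc t ht hY
    rw [← integral_stieltjesKernel ((FiniteMeasure.null_iff_toMeasure_null _ _).1 hν) hY]
    have h1 : MapClusterPt (∫ x, stieltjesKernel (Y κ t) hY x ∂(ν : Measure ℝ)) atTop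
        fun n => ∫ x, stieltjesKernel (Y κ t) hY x ∂(u n : Measure ℝ) :=
      hc.continuousAt_comp
        (FiniteMeasure.continuous_integral_boundedContinuousFunction _).continuousAt
    have h2 : Tendsto (fun n => ∫ x, stieltjesKernel (Y κ t) hY x ∂(u n : Measure ℝ)) atTop
        (𝓝 t) := by
      refine (tendsto_rootSum hκ0 hκ1 ht hY).congr' ?_
      filter_upwards [eventually_ne_atTop 0] with n hn
      exact (integral_realDist n (hroots n hn) hY).symm
    exact t2_iff_nhds.1 inferInstance (ClusterPt.mono h1 h2)
  obtain ⟨ν, hν, hc⟩ := (hK 1).exists_mapClusterPt_of_frequently hmem.frequently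
  have hstieltjes := hcluster ν hν.2 hc
  -- Every `y > 1` is some `Y κ t` with `t > 0`, so all cluster points share one Stieltjes
  -- transform; in a compact set a unique cluster point is the limit.
  have hlim : Tendsto u atTop (𝓝 ν) := by
    refine (hK 1).tendsto_nhds_of_unique_mapClusterPt hmem fun ν' hν' hc' => ?_
    have hstieltjes' := hcluster ν' hν'.2 hc'
    refine Subtype.ext (show (ν' : Measure ℝ) = (ν : Measure ℝ) from measure_eq_of_stieltjes_eq
      ((FiniteMeasure.null_iff_toMeasure_null _ _).1 hν'.2)
      ((FiniteMeasure.null_iff_toMeasure_null _ _).1 hν.2) fun y hy => ?_)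
    obtain ⟨t, ht, -, rfl⟩ := exists_Y_eq hκ0 hκ1 hz0
      ((Y_lt_one hκ0 hz0 hz le_rfl).trans hy)
    exact (hstieltjes' t ht hy).trans (hstieltjes t ht hy).symm
  refine ⟨ν, hlim, ?_, ?_, hstieltjes⟩
  -- Vanishing outside a slightly larger compact interval is a closed condition and so survives the
  -- limit; then the intervals shrink.
  · have h1 : ∀ k : ℕ, (ν : Measure ℝ) (Set.Icc (-(Y κ z + 1 / ((k : ℝ) + 1)))
        (Y κ z + 1 / ((k : ℝ) + 1)))ᶜ = 0 := fun k => by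
      have hev : ∀ᶠ n in atTop, u n ∈ {μ : FiniteMeasure ℝ | μ.mass ≤ 1 ∧
          μ (Set.Icc (-(Y κ z + 1 / ((k : ℝ) + 1))) (Y κ z + 1 / ((k : ℝ) + 1)))ᶜ = 0} := by
        filter_upwards [eventually_ne_atTop 0, eventually_roots_mem hκ0 hz0
          (show 0 < 1 / ((k : ℝ) + 1) by positivity)] with n hn hr
        exact ⟨hmass1 n hn, realDist_compl n measurableSet_Icc hr⟩
      exact (FiniteMeasure.null_iff_toMeasure_null _ _).1
        ((hK _).isClosed.mem_of_tendsto hlim hev).2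
    refine measure_mono_null (fun x hx => ?_) (measure_iUnion_null h1)
    rw [Set.mem_compl_iff, Set.mem_Icc, ← abs_le, not_le] at hx
    obtain ⟨k, hk⟩ := exists_nat_one_div_lt (sub_pos.2 hx)
    refine Set.mem_iUnion.2 ⟨k, ?_⟩
    rw [Set.mem_compl_iff, Set.mem_Icc, ← abs_le, not_le]
    linarith
  · have h1 : Tendsto (fun n => ((u n).mass : ℝ)) atTop (𝓝 (ν.mass : ℝ)) :=
      (NNReal.continuous_coe.tendsto _).comp ((FiniteMeasure.continuous_mass.tendsto ν).comp hlim)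
    refine tendsto_nhds_unique h1 (((tendsto_floor_div hκ0).const_sub 1).congr' ?_)
    filter_upwards [eventually_ne_atTop 0] with n hn
    exact (hmass n hn).symm

/-! ### Analytic continuation of the functional equation -/

/-- The Stieltjes transform of a measure on the real line. -/
noncomputable def stieltjes (ν : Measure ℝ) (w : ℂ) : ℂ := ∫ x, 1 / (w - (x : ℂ)) ∂ν

theorem stieltjes_ofReal (ν : Measure ℝ) (x : ℝ) :
    stieltjes ν x = ((∫ y, 1 / (x - y) ∂ν : ℝ) : ℂ) := by
  rw [stieltjes, ← integral_complex_ofReal]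
  congr 1
  ext y
  push_cast
  rfl

theorem differentiableAt_stieltjes {ν : Measure ℝ} [IsFiniteMeasure ν] {T : Set ℝ}
    (hT : IsClosed T) (hν : ν Tᶜ = 0) {w : ℂ} (hw : w ∉ Complex.ofReal '' T) :
    DifferentiableAt ℂ (stieltjes ν) w := by
  have hcl : IsClosed (Complex.ofReal '' T) :=
    Complex.isometry_ofReal.isClosedEmbedding.isClosedMap T hT
  obtain ⟨ε, hε, hball⟩ := Metric.isOpen_iff.1 hcl.isOpen_compl w hw
  have hdist : ∀ x ∈ T, ∀ v ∈ Metric.ball w (ε / 2), ε / 2 ≤ ‖v - x‖ := by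
    intro x hx v hv
    have h1 : (x : ℂ) ∉ Metric.ball w ε := fun h => hball h ⟨x, hx, rfl⟩
    rw [Metric.mem_ball, not_lt] at h1
    rw [Metric.mem_ball] at hv
    have h2 := dist_triangle (x : ℂ) v w
    rw [dist_comm (x : ℂ) v, dist_eq_norm v] at h2
    linarith
  have hmeas : ∀ v : ℂ, Measurable fun x : ℝ => 1 / (v - (x : ℂ)) := fun v =>
    (measurable_const.sub Complex.measurable_ofReal).const_div 1
  have hae := ae_mem_of_measure_compl hν
  refine (hasDerivAt_integral_of_dominated_loc_of_deriv_le (𝕜 := ℂ)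
    (F := fun v (x : ℝ) => 1 / (v - (x : ℂ))) (F' := fun v (x : ℝ) => -(1 / (v - (x : ℂ)) ^ 2))
    (bound := fun _ => 1 / (ε / 2) ^ 2) (Metric.ball_mem_nhds w (half_pos hε))
    (Eventually.of_forall fun v => (hmeas v).aestronglyMeasurable) ?_ ?_ ?_
    (integrable_const _) ?_).2.differentiableAt
  · refine Integrable.of_bound (hmeas w).aestronglyMeasurable (1 / (ε / 2)) (hae.mono fun x hx => ?_)
    rw [norm_div, norm_one]
    exact one_div_le_one_div_of_le (by positivity)
      (hdist x hx w (Metric.mem_ball_self (half_pos hε)))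
  · exact (((measurable_const.sub Complex.measurable_ofReal).pow_const 2).const_div
      1).neg.aestronglyMeasurable
  · refine hae.mono fun x hx v hv => ?_
    rw [norm_neg, norm_div, norm_one, norm_pow]
    have := hdist x hx v hv
    gcongr
  · refine hae.mono fun x hx v hv => ?_
    have h1 : v - (x : ℂ) ≠ 0 := fun h => by
      have := hdist x hx v hv
      rw [h, norm_zero] at this
      linarith
    simpa [one_div, neg_div] using ((hasDerivAt_id' v).sub_const (x : ℂ)).fun_inv h1

/-- The functional equation for the Stieltjes transform extends from `(1, ∞)` to all gaps of the
support. -/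
theorem stieltjes_relation {κ z : ℝ} (hκ0 : 0 < κ) (hκ1 : κ < 1) (hz0 : 0 < z)
    (hz : Real.sinh z = z / Real.sqrt κ) {ν : Measure ℝ} [IsFiniteMeasure ν]
    (hν : ν (Set.Icc (-1) 1)ᶜ = 0)
    (h : ∀ t : ℝ, 0 < t → 1 < Y κ t → ∫ x, 1 / (Y κ t - x) ∂ν = t)
    {x₀ ε : ℝ} (hε : 0 < ε) (hgap : ν (Set.Ioo (x₀ - ε) (x₀ + ε)) = 0) {g : ℝ}
    (hg : g = ∫ x, 1 / (x₀ - x) ∂ν) :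
    g * Real.cosh g - κ * Real.sinh g = x₀ * (g * Real.sinh g) := by
  set T : Set ℝ := Set.Icc (-1) 1 ∩ (Set.Ioo (x₀ - ε) (x₀ + ε))ᶜ with hT
  have hTcl : IsClosed T := isClosed_Icc.inter isOpen_Ioo.isClosed_compl
  have hTν : ν Tᶜ = 0 := by
    rw [hT, Set.compl_inter, compl_compl]
    exact measure_union_null hν hgap
  -- A connected open set joining `x₀` to `(1, ∞)` through the upper half-plane while avoiding `T`,
  -- which carries `ν`.
  set Ω : Set ℂ := Metric.ball (x₀ : ℂ) ε ∪ ({w : ℂ | 0 < w.im} ∪ {w : ℂ | 1 < w.re}) with hΩ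
  have hΩo : IsOpen Ω := Metric.isOpen_ball.union
    ((isOpen_lt continuous_const Complex.continuous_im).union
      (isOpen_lt continuous_const Complex.continuous_re))
  have hΩc : IsPreconnected Ω := by
    refine IsPreconnected.union ((x₀ : ℂ) + (ε / 2 : ℝ) * Complex.I) ?_ ?_
      (convex_ball _ _).isPreconnected
      (IsPreconnected.union (2 + Complex.I) ?_ ?_ (convex_halfSpace_im_gt 0).isPreconnected
        (convex_halfSpace_re_gt 1).isPreconnected)
    · rw [Metric.mem_ball, dist_eq_norm, add_sub_cancel_left, norm_mul, Complex.norm_I, mul_one,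
        Complex.norm_real, Real.norm_of_nonneg (by positivity)]
      linarith
    · left
      simp [hε]
    · simp
    · simp
  have hΩT : ∀ w ∈ Ω, w ∉ Complex.ofReal '' T := by
    rintro w hw ⟨x, hx, rfl⟩
    rcases hw with hw | hw | hw
    · rw [Metric.mem_ball, Complex.dist_of_im_eq (by simp), Complex.ofReal_re, Complex.ofReal_re,
        Real.dist_eq, abs_lt] at hw
      exact hx.2 ⟨by linarith, by linarith⟩
    · simp at hw
    · have : 1 < x := by simpa using hw
      linarith [hx.1.2]
  set S := stieltjes ν with hS
  -- Clearing denominators keeps `Φ` analytic even where `S` vanishes.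
  set Φ : ℂ → ℂ := fun w =>
    S w * Complex.cosh (S w) - κ * Complex.sinh (S w) - w * (S w * Complex.sinh (S w)) with hΦ
  have hdiff : DifferentiableOn ℂ Φ Ω := fun w hw => by
    have h1 : DifferentiableAt ℂ S w := differentiableAt_stieltjes hTcl hTν (hΩT w hw)
    exact (((h1.mul h1.ccosh).sub (h1.csinh.const_mul _)).sub
      (differentiableAt_id.mul (h1.mul h1.csinh))).differentiableWithinAt
  have hzero : ∀ y : ℝ, 1 < y → Φ y = 0 := by
    intro y hy
    obtain ⟨t, ht, -, rfl⟩ := exists_Y_eq hκ0 hκ1 hz0 ((Y_lt_one hκ0 hz0 hz le_rfl).trans hy)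
    have h1 : S (Y κ t : ℝ) = (t : ℂ) := by rw [hS, stieltjes_ofReal, h t ht hy]
    have h2 : t * Real.cosh t - κ * Real.sinh t - Y κ t * (t * Real.sinh t) = 0 := by
      have := (Real.sinh_pos_iff.2 ht).ne'
      rw [Y]
      field_simp
      ring
    simp only [hΦ, h1]
    exact_mod_cast h2
  have hfreq : ∃ᶠ w in 𝓝[≠] (2 : ℂ), Φ w = 0 := by
    have htend : Tendsto (fun y : ℝ => (y : ℂ)) (𝓝[≠] (2 : ℝ)) (𝓝[≠] (2 : ℂ)) := by
      refine tendsto_nhdsWithin_iff.2 ⟨?_, ?_⟩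
      · exact (Complex.continuous_ofReal.tendsto' 2 2 (by simp)).mono_left nhdsWithin_le_nhds
      · filter_upwards [self_mem_nhdsWithin] with y hy hy'
        exact hy (Complex.ofReal_injective (by simpa using hy'))
    refine htend.frequently (Eventually.frequently ?_)
    exact ((eventually_gt_nhds (by norm_num : (1 : ℝ) < 2)).filter_mono
      nhdsWithin_le_nhds).mono hzero
  have hmem2 : (2 : ℂ) ∈ Ω := by right; right; simp
  have hmem0 : (x₀ : ℂ) ∈ Ω := Or.inl (Metric.mem_ball_self hε)
  have hx := (hdiff.analyticOnNhd hΩo).eqOn_zero_of_preconnected_of_frequently_eq_zero hΩc hmem2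
    hfreq hmem0
  have h1 : S x₀ = (g : ℂ) := by rw [hS, stieltjes_ofReal, hg]
  simp only [hΦ, h1, Pi.zero_apply] at hx
  rw [sub_eq_zero] at hx
  exact_mod_cast hx

/-! ### The inverse branch and the full support -/

theorem Y_eq_of_relation {κ g x : ℝ} (hg : g ≠ 0)
    (h : g * Real.cosh g - κ * Real.sinh g = x * (g * Real.sinh g)) : Y κ g = x := by
  have hs := Real.sinh_ne_zero.2 hg
  rw [Y]
  field_simp
  linear_combination h

theorem integral_pos_of_ae_pos {ν : Measure ℝ} (hν : ν ≠ 0) {f : ℝ → ℝ} (hf : Integrable f ν)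
    (hpos : ∀ᵐ x ∂ν, 0 < f x) : 0 < ∫ x, f x ∂ν := by
  have hnn : 0 ≤ᵐ[ν] f := hpos.mono fun x hx => hx.le
  refine (integral_nonneg_of_ae hnn).lt_of_ne fun h0 => ?_
  have h1 := (integral_eq_zero_iff_of_nonneg_ae hnn hf).1 h0.symm
  have : (ae ν).NeBot := ae_neBot.2 hν
  obtain ⟨x, hx1, hx2⟩ := (h1.and hpos).exists
  exact hx2.ne' hx1

/-- A continuous solution of `Y (g x) = x` on `(Y z, ∞)` stays on the branch `(0, z)`. -/
theorem branch_mem {κ z : ℝ} (hκ0 : 0 < κ) (hz0 : 0 < z)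
    (hz : Real.sinh z = z / Real.sqrt κ) {g : ℝ → ℝ} (hcont : ContinuousOn g (Set.Ioi (Y κ z)))
    (hY : ∀ x, Y κ z < x → Y κ (g x) = x) {x : ℝ} (hx : Y κ z < x) :
    g x < z := by
  by_contra! hzx
  have hbig : ∀ u, 1 ≤ u → g u < z := fun u hu => by
    by_contra! h
    have h1 := Y_lt_one hκ0 hz0 hz h
    rw [hY u ((Y_lt_one hκ0 hz0 hz le_rfl).trans_le hu)] at h1
    linarith
  -- Crossing the level `z` at `u` would give `u = Y κ z`, which is not in the open half-line.
  obtain ⟨u, hu, hgu⟩ := isPreconnected_Ioi.intermediate_value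
    (show (1 : ℝ) ∈ Set.Ioi (Y κ z) from Y_lt_one hκ0 hz0 hz le_rfl) hx hcont
    ⟨(hbig 1 le_rfl).le, hzx⟩
  have := hY u hu
  rw [hgu] at this
  exact (this ▸ hu : Y κ z < Y κ z).false

theorem measure_compl_Icc_one {κ z : ℝ} {ν : Measure ℝ} (hκ0 : 0 < κ) (hz0 : 0 < z) (hz : Real.sinh z = z / Real.sqrt κ)
    (hν : ν (Set.Icc (-Y κ z) (Y κ z))ᶜ = 0) : ν (Set.Icc (-1) 1)ᶜ = 0 := by
  refine measure_mono_null (Set.compl_subset_compl.2 ?_) hν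
  have := Y_lt_one hκ0 hz0 hz le_rfl
  exact Set.Icc_subset_Icc (by linarith) this.le

section LimitMeasure

variable {κ z : ℝ} {ν : Measure ℝ} [IsFiniteMeasure ν]

theorem integrable_inv_sub {T : Set ℝ} (hT : IsClosed T) (hν : ν Tᶜ = 0) {x : ℝ} (hx : x ∉ T) :
    Integrable (fun y => 1 / (x - y)) ν := by
  obtain ⟨ε, hε, hball⟩ := Metric.isOpen_iff.1 hT.isOpen_compl x hx
  refine Integrable.of_bound
    ((measurable_const.sub measurable_id).const_div 1).aestronglyMeasurable (1 / ε)
    ((ae_mem_of_measure_compl hν).mono fun y hy => ?_)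
  have h1 : y ∉ Metric.ball x ε := fun h => hball h hy
  rw [Metric.mem_ball, not_lt, dist_comm, dist_eq_norm] at h1
  rw [norm_div, norm_one]
  exact one_div_le_one_div_of_le hε h1

theorem continuousOn_integral_inv_sub {T : Set ℝ} (hT : IsClosed T) (hν : ν Tᶜ = 0) :
    ContinuousOn (fun x => ∫ y, 1 / (x - y) ∂ν) Tᶜ := by
  have h1 : (fun x : ℝ => ∫ y, 1 / (x - y) ∂ν) = fun x : ℝ => (stieltjes ν x).re := by
    ext x
    rw [stieltjes_ofReal, Complex.ofReal_re]
  rw [h1]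
  intro x hx
  have h2 : (x : ℂ) ∉ Complex.ofReal '' T := by
    rintro ⟨y, hy, hxy⟩
    exact hx (Complex.ofReal_injective hxy ▸ hy)
  exact (Complex.continuous_re.continuousAt.comp
    ((differentiableAt_stieltjes hT hν h2).continuousAt.comp
      Complex.continuous_ofReal.continuousAt)).continuousWithinAt

/-- Outside the support, the Stieltjes transform of the limit is the inverse branch of `Y`. -/
theorem integral_inv_sub_mem (hκ0 : 0 < κ) (hκ1 : κ < 1) (hz0 : 0 < z)
    (hz : Real.sinh z = z / Real.sqrt κ) (hν0 : ν ≠ 0)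
    (hν : ν (Set.Icc (-Y κ z) (Y κ z))ᶜ = 0)
    (h : ∀ t : ℝ, 0 < t → 1 < Y κ t → ∫ x, 1 / (Y κ t - x) ∂ν = t)
    {x : ℝ} (hx : x ∉ Set.Icc (-Y κ z) (Y κ z)) :
    ∫ y, 1 / (x - y) ∂ν ∈ Set.Ioo (-z) 0 ∪ Set.Ioo 0 z ∧ Y κ (∫ y, 1 / (x - y) ∂ν) = x := by
  set G : ℝ → ℝ := fun x => ∫ y, 1 / (x - y) ∂ν with hG
  have hcont : ContinuousOn G (Set.Icc (-Y κ z) (Y κ z))ᶜ :=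
    continuousOn_integral_inv_sub isClosed_Icc hν
  have hrel : ∀ u, u ∉ Set.Icc (-Y κ z) (Y κ z) → G u ≠ 0 → Y κ (G u) = u := by
    intro u hu hu0
    obtain ⟨ε, hε, hball⟩ := Metric.isOpen_iff.1
      (isClosed_Icc (a := -Y κ z) (b := Y κ z)).isOpen_compl u hu
    rw [Real.ball_eq_Ioo] at hball
    exact Y_eq_of_relation hu0 (stieltjes_relation hκ0 hκ1 hz0 hz
      (measure_compl_Icc_one hκ0 hz0 hz hν) h hε (measure_mono_null hball hν) rfl)
  have hright : ∀ u, Y κ z < u → u ∉ Set.Icc (-Y κ z) (Y κ z) := fun u hu h => hu.not_ge h.2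
  have hleft : ∀ u, Y κ z < u → -u ∉ Set.Icc (-Y κ z) (Y κ z) := fun u hu h => by linarith [h.1]
  have hpos : ∀ u, Y κ z < u → 0 < G u := fun u hu =>
    integral_pos_of_ae_pos hν0 (integrable_inv_sub isClosed_Icc hν (hright u hu))
      ((ae_mem_of_measure_compl hν).mono fun y hy => one_div_pos.2 (by linarith [hy.2]))
  have hneg : ∀ u, Y κ z < u → 0 < -G (-u) := fun u hu => by
    rw [hG, ← integral_neg]
    refine integral_pos_of_ae_pos hν0 (integrable_inv_sub isClosed_Icc hν (hleft u hu)).neg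
      ((ae_mem_of_measure_compl hν).mono fun y hy => ?_)
    have := one_div_neg.2 (show -u - y < 0 by linarith [hy.1])
    linarith
  rw [Set.mem_Icc, not_and_or, not_le, not_le] at hx
  rcases hx with hx | hx
  · have hx' : Y κ z < -x := by linarith
    -- Since `Y κ` is odd, `u ↦ -G (-u)` solves the same equation on the right.
    have h1 := branch_mem (g := fun u => -G (-u)) hκ0 hz0 hz
      ((hcont.comp continuous_neg.continuousOn fun u hu => hleft u hu).neg)
      (fun u hu => by
        rw [Y_neg, hrel _ (hleft u hu) fun h0 => by linarith [hneg u hu], neg_neg]) hx'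
    have h2 := hneg (-x) hx'
    simp only [neg_neg] at h1 h2
    exact ⟨Or.inl ⟨by linarith, by linarith⟩, hrel x (fun h => by linarith [h.1])
      fun h0 => by linarith⟩
  · have h1 := branch_mem (g := G) hκ0 hz0 hz (hcont.mono fun u hu => hright u hu)
      (fun u hu => hrel u (hright u hu) (hpos u hu).ne') hx
    exact ⟨Or.inr ⟨hpos x hx, h1⟩, hrel x (hright x hx) (hpos x hx).ne'⟩

theorem measure_Ioo_ne_zero (hκ0 : 0 < κ) (hκ1 : κ < 1) (hz0 : 0 < z)
    (hz : Real.sinh z = z / Real.sqrt κ) (hν0 : ν ≠ 0)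
    (hν : ν (Set.Icc (-Y κ z) (Y κ z))ᶜ = 0)
    (h : ∀ t : ℝ, 0 < t → 1 < Y κ t → ∫ x, 1 / (Y κ t - x) ∂ν = t)
    {a b : ℝ} (hab : a < b) (ha : -Y κ z ≤ a) (hb : b ≤ Y κ z) : ν (Set.Ioo a b) ≠ 0 := by
  intro hgap
  -- A nonzero value `G` would satisfy `Y κ G = x`, and the minimum of `Y κ` on `(0, ∞)` with
  -- oddness would give `|x| ≥ Y κ z`.
  have hzero : ∀ x ∈ Set.Ioo a b, ∫ y, 1 / (x - y) ∂ν = 0 := by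
    intro x hx
    by_contra hne
    have hε : 0 < min (x - a) (b - x) := lt_min (sub_pos.2 hx.1) (sub_pos.2 hx.2)
    have hsub : Set.Ioo (x - min (x - a) (b - x)) (x + min (x - a) (b - x)) ⊆ Set.Ioo a b :=
      Set.Ioo_subset_Ioo (by linarith [min_le_left (x - a) (b - x)])
        (by linarith [min_le_right (x - a) (b - x)])
    have hY := Y_eq_of_relation hne (stieltjes_relation hκ0 hκ1 hz0 hz
      (measure_compl_Icc_one hκ0 hz0 hz hν) h hε (measure_mono_null hsub hgap) rfl)
    rcases lt_or_gt_of_ne hne with hlt | hgt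
    · have := Y_min hκ0 hz0 hz (neg_pos.2 hlt)
      rw [Y_neg, hY] at this
      linarith [hx.1]
    · have := Y_min hκ0 hz0 hz hgt
      rw [hY] at this
      linarith [hx.2]
  have hcl : IsClosed (Set.Ioo a b)ᶜ := isOpen_Ioo.isClosed_compl
  have hν' : ν (Set.Ioo a b)ᶜᶜ = 0 := by rwa [compl_compl]
  set p := (2 * a + b) / 3 with hp
  set q := (a + 2 * b) / 3 with hq
  have hpm : p ∈ Set.Ioo a b := ⟨by rw [hp]; linarith, by rw [hp]; linarith⟩
  have hqm : q ∈ Set.Ioo a b := ⟨by rw [hq]; linarith, by rw [hq]; linarith⟩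
  have hpq : p < q := by rw [hp, hq]; linarith
  have ip := integrable_inv_sub hcl hν' (x := p) (by simpa using hpm)
  have iq := integrable_inv_sub hcl hν' (x := q) (by simpa using hqm)
  -- Off the gap, `p` and `q` lie on the same side of `y`, so the integrand `(q - p) / ((p - y) (q -
  -- y))` is positive.
  have hpos : 0 < ∫ y, (1 / (p - y) - 1 / (q - y)) ∂ν := by
    refine integral_pos_of_ae_pos hν0 (ip.sub iq) ((ae_mem_of_measure_compl hν').mono fun y hy => ?_)
    rw [Set.mem_compl_iff, Set.mem_Ioo, not_and_or, not_lt, not_lt] at hy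
    have hprod : 0 < (p - y) * (q - y) := by
      rcases hy with hy | hy
      · exact mul_pos (by linarith [hpm.1]) (by linarith [hqm.1])
      · exact mul_pos_of_neg_of_neg (by linarith [hpm.2]) (by linarith [hqm.2])
    have h1 : p - y ≠ 0 := left_ne_zero_of_mul hprod.ne'
    have h2 : q - y ≠ 0 := right_ne_zero_of_mul hprod.ne'
    rw [div_sub_div _ _ h1 h2]
    exact div_pos (by linarith) hprod
  rw [integral_sub ip iq, hzero p hpm, hzero q hqm, sub_zero] at hpos
  exact hpos.false

end LimitMeasure

/-! ### Transfer to `ℂ ∪ {∞}` -/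

theorem measurableEmbedding_realPt : MeasurableEmbedding realPt :=
  OnePoint.isOpenEmbedding_coe.measurableEmbedding.comp
    Complex.isometry_ofReal.isClosedEmbedding.measurableEmbedding

theorem continuous_realPt : Continuous realPt :=
  OnePoint.continuous_coe.comp Complex.continuous_ofReal

theorem realPt_ne_infty (x : ℝ) : realPt x ≠ ∞ := OnePoint.coe_ne_infty _

theorem map_sum_dirac (s : Multiset ℝ) :
    ((s.map fun r : ℝ => (diracProba r).toFiniteMeasure).sum).map realPt =
      (s.map fun r : ℝ => (diracProba (realPt r)).toFiniteMeasure).sum := by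
  induction s using Multiset.induction_on with
  | empty =>
    refine Subtype.ext ?_
    simp [FiniteMeasure.toMeasure_map]
  | cons a s ih =>
    rw [Multiset.map_cons, Multiset.sum_cons, Multiset.map_cons, Multiset.sum_cons,
      FiniteMeasure.map_add measurableEmbedding_realPt.measurable, ih]
    congr 1
    refine Subtype.ext ?_
    exact Measure.map_dirac' measurableEmbedding_realPt.measurable a

/-- All complex zeros are real, so the finite part is a push-forward from the line. -/
theorem zeroDist_eq (n : ℕ) {P : ℝ[X]} (hP : P.Splits) :
    zeroDist n P = (realDist n P).map realPt +
      ((n : ℝ≥0)⁻¹ * (n - P.natDegree : ℕ)) • (diracProba (∞ : OnePoint ℂ)).toFiniteMeasure := by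
  have h1 : P.aroots ℂ = P.roots.map Complex.ofReal := by
    rw [Polynomial.aroots]
    exact hP.roots_map (algebraMap ℝ ℂ)
  rw [zeroDist, realDist, FiniteMeasure.map_smul, map_sum_dirac, smul_add, h1, Multiset.map_map,
    mul_smul, Nat.cast_smul_eq_nsmul]
  rfl

/-- The limit measure on `ℂ ∪ {∞}` built from its restriction `ν` to the real line. -/
noncomputable def addAtom (κ : ℝ) (ν : Measure ℝ) : Measure (OnePoint ℂ) :=
  ν.map realPt + ENNReal.ofReal κ • Measure.dirac (∞ : OnePoint ℂ)

theorem addAtom_infty (κ : ℝ) (ν : Measure ℝ) :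
    addAtom κ ν {(∞ : OnePoint ℂ)} = ENNReal.ofReal κ := by
  have h : realPt ⁻¹' {(∞ : OnePoint ℂ)} = ∅ := by
    ext x
    simp [realPt_ne_infty]
  rw [addAtom, Measure.add_apply, measurableEmbedding_realPt.map_apply, h]
  simp

theorem support_addAtom {κ a b : ℝ} {ν : Measure ℝ} (hκ0 : 0 < κ) (hab : a < b)
    (hν : ν (Set.Icc a b)ᶜ = 0)
    (hpos : ∀ c d : ℝ, c < d → a ≤ c → d ≤ b → ν (Set.Ioo c d) ≠ 0) :
    (addAtom κ ν).support = realPt '' Set.Icc a b ∪ {(∞ : OnePoint ℂ)} := by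
  refine Set.Subset.antisymm ?_ ?_
  · refine Measure.support_subset_of_isClosed
      ((isCompact_Icc.image continuous_realPt).isClosed.union isClosed_singleton) ?_
    have h1 : realPt ⁻¹' (realPt '' Set.Icc a b ∪ {(∞ : OnePoint ℂ)})ᶜ = (Set.Icc a b)ᶜ := by
      ext x
      simp [realPt_ne_infty, measurableEmbedding_realPt.injective.eq_iff]
    rw [mem_ae_iff, addAtom, Measure.add_apply, measurableEmbedding_realPt.map_apply, h1, hν]
    simp
  · rintro w (⟨x, hx, rfl⟩ | rfl)
    · rw [Measure.mem_support_iff_forall]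
      intro U hU
      have h1 : realPt ⁻¹' U ∈ 𝓝 x := continuous_realPt.continuousAt hU
      obtain ⟨ε, hε, hball⟩ := Metric.mem_nhds_iff.1 h1
      rw [Real.ball_eq_Ioo] at hball
      -- Truncation to `[a, b]` leaves a nonempty interval even when `x` is an endpoint.
      have h2 : 0 < ν (Set.Ioo (max a (x - ε)) (min b (x + ε))) := by
        refine pos_iff_ne_zero.2 (hpos _ _ ?_ (le_max_left _ _) (min_le_left _ _))
        rw [max_lt_iff, lt_min_iff, lt_min_iff]
        exact ⟨⟨hab, by linarith [hx.1]⟩, by linarith [hx.2], by linarith⟩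
      have h3 : ν (Set.Ioo (max a (x - ε)) (min b (x + ε))) ≤ ν (realPt ⁻¹' U) :=
        measure_mono ((Set.Ioo_subset_Ioo (le_max_right _ _) (min_le_right _ _)).trans hball)
      rw [addAtom, Measure.add_apply, measurableEmbedding_realPt.map_apply]
      exact lt_of_lt_of_le (h2.trans_le h3) le_self_add
    · rw [Measure.mem_support_iff_forall]
      intro U hU
      refine lt_of_lt_of_le ?_ (measure_mono (Set.singleton_subset_iff.2 (mem_of_mem_nhds hU)))
      rw [addAtom_infty]
      exact ENNReal.ofReal_pos.2 hκ0

theorem cauchyTransform_addAtom (κ : ℝ) {ν : Measure ℝ} [IsFiniteMeasure ν] {T : Set ℝ}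
    (hT : IsClosed T) (hν : ν Tᶜ = 0) {x : ℝ} (hx : x ∉ T) :
    cauchyTransform (addAtom κ ν) x = ((∫ y, 1 / (x - y) ∂ν : ℝ) : ℂ) := by
  have h0 : (fun y : ℝ => (realPt y).elim (0 : ℂ) fun z : ℂ => 1 / ((x : ℂ) - z)) =
      fun y : ℝ => ((1 / (x - y) : ℝ) : ℂ) := by
    ext y
    simp [realPt]
  rw [cauchyTransform, addAtom, integral_add_measure, measurableEmbedding_realPt.integral_map, h0,
    integral_complex_ofReal, integral_smul_measure, integral_dirac]
  · simp
  · rw [measurableEmbedding_realPt.integrable_map_iff]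
    rw [Function.comp_def, h0]
    exact (integrable_inv_sub hT hν hx).ofReal
  · exact (integrable_dirac (by simp)).smul_measure ENNReal.ofReal_ne_top

theorem tendsto_zeroDist {κ : ℝ} (hκ0 : 0 < κ) (hκ1 : κ < 1) {ν : FiniteMeasure ℝ}
    (hlim : Tendsto (fun n : ℕ => realDist n (rescaledDeriv κ n)) atTop (𝓝 ν)) :
    Tendsto (fun n : ℕ => zeroDist n (rescaledDeriv κ n)) atTop
      (𝓝 (ν.map realPt + κ.toNNReal • (diracProba (∞ : OnePoint ℂ)).toFiniteMeasure)) := by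
  have h1 := FiniteMeasure.tendsto_map_of_tendsto_of_continuous _ _ hlim continuous_realPt
  have h2 : Tendsto (fun n : ℕ => (n : ℝ≥0)⁻¹ * (n - (rescaledDeriv κ n).natDegree : ℕ)) atTop
      (𝓝 κ.toNNReal) := by
    rw [← NNReal.tendsto_coe, Real.coe_toNNReal _ hκ0.le]
    refine (tendsto_floor_div hκ0).congr' ?_
    filter_upwards [eventually_ne_atTop 0] with n hn
    rw [rescaledDeriv_eq, natDegree_iterate_derivative_eq, natDegree_rescaledPoly,
      Nat.sub_sub_self (floor_lt hκ0 hκ1 hn).le, div_eq_inv_mul]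
    simp
  refine (h1.add (h2.smul_const _)).congr fun n => ?_
  exact (zeroDist_eq n (splits_iterate_derivative (splits_rescaledPoly n) _)).symm

end EquispacedDerivatives

/-! ### The main theorem -/

theorem mainTheorem12 (κ : ℝ) (hκ0 : 0 < κ) (hκ1 : κ < 1) :
    (∃! z : ℝ, 0 < z ∧ Real.sinh z = z / Real.sqrt κ) ∧
    ∃ μ : ProbabilityMeasure (OnePoint ℂ),
      Tendsto
        (fun n : ℕ => EquispacedDerivatives.zeroDist n (EquispacedDerivatives.rescaledDeriv κ n))
        atTop (𝓝 μ.toFiniteMeasure) ∧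
      (μ : Measure (OnePoint ℂ)) {(∞ : OnePoint ℂ)} = ENNReal.ofReal κ ∧
      ∀ z : ℝ, 0 < z → Real.sinh z = z / Real.sqrt κ →
        -1 < EquispacedDerivatives.Y κ (-z) ∧
        EquispacedDerivatives.Y κ (-z) < EquispacedDerivatives.Y κ z ∧
        EquispacedDerivatives.Y κ z < 1 ∧
        (μ : Measure (OnePoint ℂ)).support =
          EquispacedDerivatives.realPt ''
            Set.Icc (EquispacedDerivatives.Y κ (-z)) (EquispacedDerivatives.Y κ z) ∪
              {(∞ : OnePoint ℂ)} ∧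
        StrictAntiOn (EquispacedDerivatives.Y κ) (Set.Ioo (-z) 0) ∧
        StrictAntiOn (EquispacedDerivatives.Y κ) (Set.Ioo 0 z) ∧
        Set.BijOn (EquispacedDerivatives.Y κ) (Set.Ioo (-z) 0 ∪ Set.Ioo 0 z)
          (Set.Icc (EquispacedDerivatives.Y κ (-z)) (EquispacedDerivatives.Y κ z))ᶜ ∧
        ∀ x : ℝ,
          x ∉ Set.Icc (EquispacedDerivatives.Y κ (-z)) (EquispacedDerivatives.Y κ z) →
          EquispacedDerivatives.cauchyTransform (μ : Measure (OnePoint ℂ)) (x : ℂ) =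
            ((Function.invFunOn (EquispacedDerivatives.Y κ)
              (Set.Ioo (-z) 0 ∪ Set.Ioo 0 z) x : ℝ) : ℂ) := by
  obtain ⟨z₀, ⟨hz0, hz⟩, huniq⟩ := EquispacedDerivatives.existsUnique_critical hκ0 hκ1
  refine ⟨⟨z₀, ⟨hz0, hz⟩, huniq⟩, ?_⟩
  obtain ⟨ν, hlim, hνs, hmass, hst⟩ := EquispacedDerivatives.exists_limit hκ0 hκ1 hz0 hz
  have hreal : (ν : Measure ℝ).real Set.univ = 1 - κ := hmass
  have huniv : (ν : Measure ℝ) Set.univ = ENNReal.ofReal (1 - κ) := by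
    rw [← hreal, ofReal_measureReal]
  have hν0 : (ν : Measure ℝ) ≠ 0 := by
    intro h0
    rw [h0, measureReal_zero_apply] at hreal
    linarith
  have hprob : IsProbabilityMeasure (EquispacedDerivatives.addAtom κ (ν : Measure ℝ)) := ⟨by
    rw [EquispacedDerivatives.addAtom, Measure.add_apply,
      EquispacedDerivatives.measurableEmbedding_realPt.map_apply, Set.preimage_univ, huniv,
      Measure.smul_apply, measure_univ, smul_eq_mul, mul_one,
      ← ENNReal.ofReal_add (by linarith) hκ0.le]
    simp⟩
  refine ⟨⟨_, hprob⟩, ?_, EquispacedDerivatives.addAtom_infty _ _, ?_⟩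
  · convert EquispacedDerivatives.tendsto_zeroDist hκ0 hκ1 hlim using 2
    refine Subtype.ext ?_
    change EquispacedDerivatives.addAtom κ (ν : Measure ℝ) = _
    rw [EquispacedDerivatives.addAtom]
    rfl
  · intro z hz0' hz'
    obtain rfl : z = z₀ := huniq z ⟨hz0', hz'⟩
    have hs0 := EquispacedDerivatives.Y_critical_pos hκ0 hz0 hz
    have hs1 := EquispacedDerivatives.Y_lt_one hκ0 hz0 hz le_rfl
    have hbij := EquispacedDerivatives.bijOn_Y hκ0 hκ1 hz0 hz
    rw [EquispacedDerivatives.Y_neg] at hbij ⊢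
    refine ⟨by linarith, by linarith, hs1, ?_,
      EquispacedDerivatives.strictAntiOn_Y_neg hκ0 hz,
      (EquispacedDerivatives.strictAntiOn_Y hκ0 hz).mono Set.Ioo_subset_Ioc_self, hbij, ?_⟩
    · exact EquispacedDerivatives.support_addAtom hκ0 (by linarith) hνs fun c d hcd hc hd =>
        EquispacedDerivatives.measure_Ioo_ne_zero hκ0 hκ1 hz0 hz hν0 hνs hst hcd hc hd
    · intro x hx
      obtain ⟨hmem, hY⟩ :=
        EquispacedDerivatives.integral_inv_sub_mem hκ0 hκ1 hz0 hz hν0 hνs hst hx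
      refine (EquispacedDerivatives.cauchyTransform_addAtom κ isClosed_Icc hνs hx).trans ?_
      congr 1
      have hex : ∃ t ∈ Set.Ioo (-z) 0 ∪ Set.Ioo 0 z, EquispacedDerivatives.Y κ t = x :=
        ⟨_, hmem, hY⟩
      -- `Function.invFunOn` only chooses some preimage; injectivity on the two branches identifies
      -- it with the integral.
      exact hbij.injOn hmem (Function.invFunOn_mem hex)
        (hY.trans (Function.invFunOn_eq hex).symm)
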